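/- **Proposition 3.6.** There exists an absolute constant $\kappa>0$ with the following property. Let $(\Omega,\mathcal F,\mathbb P,(\mathcal F_t)_{t\ge 0})$ be a filtered probability space and let $\beta$ be a standard real Brownian motion with respect to $(\mathcal F_t)_{t\ge0}$ (adapted, almost surely continuous, with $\beta(t)-\beta(s)$ independent of $\mathcal F_s$ for $0\le s\le t$). For $t,\sigma\ge 0$ let $$S(t,\sigma)=e^{\,i(\beta(t)-\beta(\sigma))\Delta}$$ be the white-noise Schrödinger propagator on $L^2(\mathbb R)=L^2(\mathbb R;\mathbb C)$, that is, $\widehat{S(t,\sigma)u}(\xi)=e^{-i|\xi|^2(\beta(t)-\beta(\sigma))}\,\hat u(\xi)$, where $\hat u(\xi)$ is the Fourier transform with characters $e^{-ix\xi}$. For a Banach space $K$, $1\le r,p<\infty$ and $s,T\ge0$ let $L^r_{\mathcal P}(\Omega;L^p(s,s+T;K))$ denote the space of (classes, modulo $dt\otimes\mathbb P$-a.e. equality, of) predictable $K$-valued processes $f$ on $(s,s+T)\times\Omega$ with $$\|f\|_{L^r(\Omega;L^p(s,s+T;K))}=\Big(\mathbb E\Big[\Big(\int_s^{s+T}\|f(t)\|_K^p\,dt\Big)^{r/p}\Big]\Big)^{1/r}<\infty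 .$$ Then for all $s\ge 0$, $T\ge 0$ and all $f\in L^4_{\mathcal P}(\Omega;L^1(s,s+T;L^2(\mathbb R)))$: almost surely, for every $t\in[s,s+T]$, the function $\sigma\mapsto S(t,\sigma)f(\sigma)$ is Bochner integrable on $(s,t)$ in $L^2(\mathbb R)$; the mapping $t\mapsto\int_s^tS(t,\sigma)f(\sigma)\,d\sigma$ belongs to $L^4_{\mathcal P}(\Omega;L^5(s,s+T;L^{10}(\mathbb R)))$; and $$\Big\|\int_s^{\cdot}S(\cdot,\sigma)f(\sigma)\,d\sigma\Big\|_{L^4(\Omega;L^5(s,s+T;L^{10}(\mathbb R)))}\le\kappa\,T^{1/10}\,\|f\|_{L^4(\Omega;L^1(s,s+T;L^2(\mathbb R)))}.$$ -/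

import Mathlib

open MeasureTheory ProbabilityTheory
open scoped NNReal ENNReal FourierTransform

noncomputable section

/-- Lebesgue measure on the time axis `[0, ∞)`. -/
def timeVolume : Measure ℝ≥0 := Measure.comap (fun t : ℝ≥0 => (t : ℝ)) volume

/-- The complex Hilbert space `L²(ℝ)` (Lebesgue measure). -/
abbrev L2R : Type := Lp ℂ 2 (volume : Measure ℝ)

/-- The complex Banach space `L¹⁰(ℝ)` (Lebesgue measure). -/
abbrev L10R : Type := Lp ℂ 10 (volume : Measure ℝ)

instance fact_one_le_ten : Fact ((1 : ℝ≥0∞) ≤ 10) := ⟨by norm_num⟩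

/-- `β` is a real Brownian motion with respect to the filtration `𝔽`: it is a standard Brownian
motion, it is adapted, and its increments after time `s` are independent of `𝔽 s`. -/
structure IsFilteredBrownian {Ω : Type*} {mΩ : MeasurableSpace Ω} (P : Measure Ω)
    (𝔽 : Filtration ℝ≥0 mΩ) (β : ℝ≥0 → Ω → ℝ) : Prop where
  brownian : IsBrownianReal β P
  adapted : StronglyAdapted 𝔽 β
  indep : ∀ s t : ℝ≥0, s ≤ t →
    Indep (MeasurableSpace.comap (fun ω => β t ω - β s ω) inferInstance) (𝔽 s) P

/-- The symbol of `exp (i b Δ)`. Mathlib's Fourier transform uses the frequency `ξ` with character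
`exp (-2 π i x ξ)`, so `Δ` has the symbol `-(2 π ξ)²`. -/
def schrodingerSymbol (b ξ : ℝ) : ℂ :=
  Complex.exp (-(Complex.I * ((b * (2 * Real.pi * ξ) ^ 2 : ℝ) : ℂ)))

lemma norm_schrodingerSymbol (b ξ : ℝ) : ‖schrodingerSymbol b ξ‖ = 1 := by
  rw [schrodingerSymbol, ← mul_neg, ← Complex.ofReal_neg, mul_comm]
  exact Complex.norm_exp_ofReal_mul_I _

lemma continuous_schrodingerSymbol (b : ℝ) : Continuous (schrodingerSymbol b) := by
  unfold schrodingerSymbol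
  fun_prop

lemma memLp_schrodingerSymbol_mul (b : ℝ) (g : L2R) :
    MemLp (fun ξ => schrodingerSymbol b ξ * g ξ) 2 (volume : Measure ℝ) := by
  refine (Lp.memLp g).of_le ?_ (Filter.Eventually.of_forall fun ξ => ?_)
  · exact (continuous_schrodingerSymbol b).aestronglyMeasurable.mul
      (Lp.aestronglyMeasurable g)
  · rw [norm_mul, norm_schrodingerSymbol, one_mul]

/-- The Schrödinger group `exp (i b Δ)` on `L²(ℝ)`: the Fourier transform of `u` is multiplied by
`exp (-i b |2πξ|²)`. -/
def schrodingerGroup (b : ℝ) (u : L2R) : L2R :=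
  𝓕⁻ ((memLp_schrodingerSymbol_mul b (𝓕 u)).toLp _ : L2R)

/-- The white noise propagator `S(t, σ) = exp (i (β(t) - β(σ)) Δ)` at the sample point `ω`. -/
def noisePropagator {Ω : Type*} (β : ℝ≥0 → Ω → ℝ) (t σ : ℝ≥0) (ω : Ω) (u : L2R) : L2R :=
  schrodingerGroup (β t ω - β σ ω) u

/-- The Duhamel term `∫ₛᵗ S(t, σ) f(σ) dσ`, a Bochner integral in `L²(ℝ)`. -/
def duhamel {Ω : Type*} (β : ℝ≥0 → Ω → ℝ) (f : ℝ≥0 → Ω → L2R) (s t : ℝ≥0) (ω : Ω) : L2R :=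
  ∫ σ in Set.Ioc s t, noisePropagator β t σ ω (f σ ω) ∂timeVolume

/-- The norm of `f` in `L^r(Ω; L^p(s, s+T; K))`, as an extended nonnegative number. -/
def mixedNorm {Ω : Type*} {mΩ : MeasurableSpace Ω} {K : Type*} [NormedAddCommGroup K]
    (P : Measure Ω) (r p : ℝ≥0∞) (s T : ℝ≥0) (f : ℝ≥0 → Ω → K) : ℝ≥0∞ :=
  eLpNorm (fun ω => eLpNorm (fun t => f t ω) p (timeVolume.restrict (Set.Ioc s (s + T)))) r P

/-- Membership in the space `L^r_𝓟(Ω; L^p(s, s+T; K))` of predictable processes. Elements of this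
space are classes of processes modulo equality `dt ⊗ P`-almost everywhere on `(s, s+T) × Ω`, hence
`f` is required to agree almost everywhere there with a predictable process. -/
structure MemMixedPredictable {Ω : Type*} {mΩ : MeasurableSpace Ω} {K : Type*}
    [NormedAddCommGroup K] (P : Measure Ω) (𝔽 : Filtration ℝ≥0 mΩ) (r p : ℝ≥0∞) (s T : ℝ≥0)
    (f : ℝ≥0 → Ω → K) : Prop where
  exists_predictable : ∃ g : ℝ≥0 → Ω → K, IsStronglyPredictable 𝔽 g ∧
    ∀ᵐ z ∂((timeVolume.restrict (Set.Ioc s (s + T))).prod P), f z.1 z.2 = g z.1 z.2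
  norm_lt_top : mixedNorm P r p s T f < ∞

end

/-!
The estimate rests on local smoothing *on average*. Write the Duhamel term as
`v(t) = S(t, 0) ∫ₛᵗ h(σ) dσ` with `h(σ) = S(0, σ) f(σ)`, so that the norms of `h(σ)` and `f(σ)` in
`L²` agree, and let `a(σ)` be the Fourier transform of `h(σ)`. The Fourier transform of `|v(t)|²` at
`ξ` is an autocorrelation, and its squared modulus expands into an integral over four times
`σ₁, …, σ₄` and two frequencies `η₁, η₂` of a product of four amplitudes `a(σᵢ)` times the
oscillation `exp (-i c ξ (η₁ - η₂) β(t))` (`duhamelDensity_mul_conj`,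
`schrodingerSymbol_resonance`). The amplitudes are known at the latest time `m = max σᵢ`, and
`β(t) - β(m)` is a centred Gaussian variable independent of the past, so that the expectation gains
the factor `exp (-c² ξ² (η₁ - η₂)² (t - m) / 2)` (`enorm_integral_exp_brownian_mul_le`). The
integral of this factor in one of the frequencies is a multiple of `|ξ|⁻¹ (t - m)^(-1/2)`, and the
Cauchy–Schwarz inequality leaves the product of the four norms of `h(σᵢ)`
(`lintegral_resonance_quadrilinear_le`).
The singularity `(t - m)^(-1/2)` is integrable in `t`, which gives

  `E ∫ ∫ |ξ| |𝓕(|v(t)|²)(ξ)|² dξ dt ≤ 2 T^(1/2) E (∫ ‖f(σ)‖ dσ)⁴`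

(`lintegral_localSmoothing_le`).

A Gagliardo–Nirenberg inequality for the density `w = |v|²`, between `L¹` and the homogeneous
Sobolev space of order `1/2`, bounds the fifth power of the norm of `v` in `L¹⁰` by `‖v‖` times the
inner integral above (`eLpNorm_ten_pow_five_le`); and `‖v(t)‖ ≤ ∫ ‖f(σ)‖ dσ`. Hölder's inequality
in `ω` with exponents `5` and `5/4` concludes (`lintegral_pow_four_le`,
`mixedNorm_toL10_duhamelVersion_le`).

Measurability needs some care. A class in `L²(ℝ)` is given a representative which is jointly
measurable in the class and the point (`lebesgueRep`), in order to apply Tonelli's theorem to the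
amplitudes. The Brownian motion and the primitive of `h` are adapted with almost surely continuous
paths; their left limits along grids (`leftLimitProcess`) are predictable and almost surely
indistinguishable from them, which yields a predictable version of the Duhamel term
(`duhamelVersion`). The map from `L²` to `L¹⁰`, extended by zero, is Borel measurable
(`measurable_toL10`).
-/

/-! ### The Fourier transform on `L²(ℝ)` -/

section FourierOnL2

open SchwartzMap

lemma ae_eq_of_integral_schwartz_smul_eq {f g : ℝ → ℂ} (hf : LocallyIntegrable f)
    (hg : LocallyIntegrable g) (h : ∀ φ : 𝓢(ℝ, ℂ), ∫ x, φ x • f x = ∫ x, φ x • g x) :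
    f =ᵐ[volume] g := by
  refine ae_eq_of_integral_contDiff_smul_eq hf hg fun φ φ_smooth φ_cpt => ?_
  have h₁ : HasCompactSupport (Complex.ofRealCLM ∘ φ) := φ_cpt.comp_left rfl
  have h₂ : ContDiff ℝ (⊤ : ℕ∞) (Complex.ofRealCLM ∘ φ) := by fun_prop
  simpa using h (h₁.toSchwartzMap h₂)

lemma integral_schwartz_smul_fourier_L2 (φ : 𝓢(ℝ, ℂ)) (u : L2R) :
    ∫ x, φ x • (𝓕 u : L2R) x = ∫ x, (𝓕 φ) x • u x := by
  have h := DFunLike.congr_fun (Lp.fourier_toTemperedDistribution_eq u) φ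
  rw [TemperedDistribution.fourier_apply, Lp.toTemperedDistribution_apply,
    Lp.toTemperedDistribution_apply] at h
  exact h.symm

lemma integral_schwartz_smul_fourierInv_L2 (φ : 𝓢(ℝ, ℂ)) (u : L2R) :
    ∫ x, φ x • (𝓕⁻ u : L2R) x = ∫ x, (𝓕⁻ φ) x • u x := by
  have h := DFunLike.congr_fun (Lp.fourierInv_toTemperedDistribution_eq u) φ
  rw [TemperedDistribution.fourierInv_apply, Lp.toTemperedDistribution_apply,
    Lp.toTemperedDistribution_apply] at h
  exact h.symm

lemma integral_schwartz_smul_fourier_L1 (φ : 𝓢(ℝ, ℂ)) {w : ℝ → ℂ} (hw : Integrable w) :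
    ∫ x, φ x • 𝓕 w x = ∫ x, (𝓕 φ) x • w x := by
  have h := VectorFourier.integral_fourierIntegral_smul_eq_flip (e := Real.fourierChar)
    (L := innerₗ ℝ) (μ := (volume : Measure ℝ)) (ν := (volume : Measure ℝ))
    Real.continuous_fourierChar continuous_inner φ.integrable hw
  rw [flip_innerₗ] at h
  exact h.symm

lemma integral_schwartz_smul_fourierInv_L1 (φ : 𝓢(ℝ, ℂ)) {w : ℝ → ℂ} (hw : Integrable w) :
    ∫ x, φ x • 𝓕⁻ w x = ∫ x, (𝓕⁻ φ) x • w x := by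
  have h := integral_schwartz_smul_fourier_L1 φ hw.comp_neg
  have h1 : ∀ x, 𝓕⁻ w x = 𝓕 (fun y => w (-y)) x := fun x => by
    rw [Real.fourierInv_eq_fourier_comp_neg]
  simp_rw [h1, h]
  rw [← integral_neg_eq_self]
  simp [SchwartzMap.fourierInv_coe, SchwartzMap.fourier_coe, Real.fourierInv_eq_fourier_neg]

lemma continuous_fourier_of_integrable {w : ℝ → ℂ} (hw : Integrable w) : Continuous (𝓕 w) :=
  VectorFourier.fourierIntegral_continuous Real.continuous_fourierChar continuous_inner hw

lemma norm_fourier_le_integral_norm (w : ℝ → ℂ) (ξ : ℝ) : ‖𝓕 w ξ‖ ≤ ∫ x, ‖w x‖ :=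
  VectorFourier.norm_fourierIntegral_le_integral_norm _ _ _ _ _

/-- On `L¹ ∩ L²`, the inverse Fourier transform of `L²` is given by the integral formula; in
particular it is bounded by the `L¹` norm. -/
lemma norm_fourierInv_L2_le (u : L2R) (hu : Integrable u) :
    ∀ᵐ x, ‖(𝓕⁻ u : L2R) x‖ ≤ ∫ ξ, ‖u ξ‖ := by
  have h : (𝓕⁻ u : L2R) =ᵐ[volume] 𝓕⁻ (u : ℝ → ℂ) := by
    refine ae_eq_of_integral_schwartz_smul_eq ((Lp.memLp _).locallyIntegrable (by norm_num)) ?_ ?_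
    · rw [Real.fourierInv_eq_fourier_comp_neg]
      exact (continuous_fourier_of_integrable hu.comp_neg).locallyIntegrable
    · intro φ
      rw [integral_schwartz_smul_fourierInv_L2, integral_schwartz_smul_fourierInv_L1 φ hu]
  filter_upwards [h] with x hx
  rw [hx, Real.fourierInv_eq_fourier_neg]
  exact norm_fourier_le_integral_norm _ _

/-- An integrable function whose Fourier transform is square integrable is the inverse Fourier
transform, in the sense of `L²`, of its Fourier transform. -/
lemma fourierInv_toLp_fourier_ae_eq {w : ℝ → ℂ} (hw : Integrable w) (hW : MemLp (𝓕 w) 2) :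
    (𝓕⁻ (hW.toLp : L2R) : L2R) =ᵐ[volume] w := by
  refine ae_eq_of_integral_schwartz_smul_eq ((Lp.memLp _).locallyIntegrable (by norm_num))
    hw.locallyIntegrable fun φ => ?_
  rw [integral_schwartz_smul_fourierInv_L2]
  have h1 : ∫ x, (𝓕⁻ φ) x • (hW.toLp : L2R) x = ∫ x, (𝓕⁻ φ) x • 𝓕 w x := by
    refine integral_congr_ae ?_
    filter_upwards [hW.coeFn_toLp] with x hx
    rw [hx]
  rw [h1, integral_schwartz_smul_fourier_L1 _ hw]
  simp

lemma memLp_fourierChar_mul (ξ : ℝ) (v : L2R) :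
    MemLp (fun x => (Real.fourierChar (-(x * ξ)) : ℂ) * v x) 2 (volume : Measure ℝ) := by
  refine (Lp.memLp v).of_le ?_ (Filter.Eventually.of_forall fun x => by
    rw [norm_mul, Circle.norm_coe, one_mul])
  refine AEStronglyMeasurable.mul ?_ (Lp.aestronglyMeasurable v)
  have h : Continuous fun x : ℝ => (Real.fourierChar (-(x * ξ)) : ℂ) := by fun_prop
  exact h.aestronglyMeasurable

/-- The Fourier transform turns modulations into translations. -/
lemma fourier_modulation_ae_eq (ξ : ℝ) (v : L2R) :
    (𝓕 ((memLp_fourierChar_mul ξ v).toLp _ : L2R) : L2R) =ᵐ[volume]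
      fun η => (𝓕 v : L2R) (η + ξ) := by
  have hmp : MeasurePreserving (fun η : ℝ => η + ξ) := measurePreserving_add_right volume ξ
  refine ae_eq_of_integral_schwartz_smul_eq ((Lp.memLp _).locallyIntegrable (by norm_num))
    (((Lp.memLp (𝓕 v : L2R)).comp_measurePreserving hmp).locallyIntegrable (by norm_num))
    fun φ => ?_
  rw [integral_schwartz_smul_fourier_L2]
  have h1 : ∫ x, (𝓕 φ) x • ((memLp_fourierChar_mul ξ v).toLp _ : L2R) x
      = ∫ x, (𝓕 (compSubConstCLM ℂ ξ φ)) x • v x := by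
    refine integral_congr_ae ?_
    filter_upwards [(memLp_fourierChar_mul ξ v).coeFn_toLp] with x hx
    rw [hx]
    have : (𝓕 (compSubConstCLM ℂ ξ φ)) x = (Real.fourierChar (-(x * ξ)) : ℂ) * (𝓕 φ) x := by
      rw [SchwartzMap.fourier_coe, SchwartzMap.fourier_coe, Real.fourier_real_eq,
        Real.fourier_real_eq, ← integral_const_mul,
        ← integral_add_right_eq_self _ ξ]
      refine integral_congr_ae (Filter.Eventually.of_forall fun y => ?_)
      simp only [compSubConstCLM_apply, add_sub_cancel_right, Circle.smul_def, smul_eq_mul]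
      rw [← mul_assoc, ← Circle.coe_mul, ← AddChar.map_add_eq_mul]
      ring_nf
    rw [this]
    simp only [smul_eq_mul]; ring
  rw [h1, ← integral_schwartz_smul_fourier_L2, ← integral_add_right_eq_self _ ξ]
  simp

lemma integrable_mul_conj_self (v : L2R) : Integrable (fun x => v x * (starRingEnd ℂ) (v x)) := by
  have h := (memLp_two_iff_integrable_sq_norm (Lp.aestronglyMeasurable v)).1 (Lp.memLp v)
  refine (h.ofReal (𝕜 := ℂ)).congr (Filter.Eventually.of_forall fun x => ?_)
  simp [Complex.mul_conj, Complex.normSq_eq_norm_sq]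

/-- The Fourier transform of `|v|²` is the autocorrelation of the Fourier transform of `v`. -/
lemma fourier_mul_conj_self (v : L2R) (ξ : ℝ) :
    𝓕 (fun x => v x * (starRingEnd ℂ) (v x)) ξ
      = ∫ η, (𝓕 v : L2R) (η + ξ) * (starRingEnd ℂ) ((𝓕 v : L2R) η) := by
  have h := Lp.inner_fourier_eq v ((memLp_fourierChar_mul ξ v).toLp _ : L2R)
  rw [L2.inner_def, L2.inner_def] at h
  rw [Real.fourier_real_eq]
  calc _ = ∫ x, inner ℂ (v x) (((memLp_fourierChar_mul ξ v).toLp _ : L2R) x) := by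
        refine integral_congr_ae ?_
        filter_upwards [(memLp_fourierChar_mul ξ v).coeFn_toLp] with x hx
        rw [hx, RCLike.inner_apply, Circle.smul_def, smul_eq_mul]
        ring
    _ = _ := h.symm
    _ = _ := by
        refine integral_congr_ae ?_
        filter_upwards [fourier_modulation_ae_eq ξ v] with x hx
        rw [hx, RCLike.inner_apply]

end FourierOnL2

/-! ### The Gagliardo–Nirenberg inequality for the density -/

section GagliardoNirenberg

lemma lintegral_enorm_sq_L2 (u : L2R) : ∫⁻ x, ‖u x‖ₑ ^ 2 = ‖u‖ₑ ^ 2 := by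
  rw [Lp.enorm_def, eLpNorm_eq_lintegral_rpow_enorm_toReal (by norm_num) (by norm_num)]
  simp only [ENNReal.toReal_ofNat, ENNReal.rpow_ofNat]
  rw [← ENNReal.rpow_natCast, ← ENNReal.rpow_mul]
  norm_num

lemma lintegral_abs_rpow_Icc_le {R : ℝ} (hR : 0 ≤ R) :
    ∫⁻ ξ in {ξ : ℝ | |ξ| ≤ R}, ENNReal.ofReal (|ξ| ^ (-(3 / 5) : ℝ))
      ≤ ENNReal.ofReal (5 * R ^ (2 / 5 : ℝ)) := by
  have hm : MeasurableSet {ξ : ℝ | |ξ| ≤ R} := measurableSet_le (by fun_prop) (by fun_prop)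
  have h0 : IntegrableOn (fun x : ℝ => x ^ (-(3 / 5) : ℝ)) (Set.Ioc 0 R) :=
    (intervalIntegrable_iff_integrableOn_Ioc_of_le hR).1
      (intervalIntegral.intervalIntegrable_rpow' (by norm_num))
  have h1 : ∫ x in Set.Ioc 0 R, x ^ (-(3 / 5) : ℝ) = 5 / 2 * R ^ (2 / 5 : ℝ) := by
    rw [← intervalIntegral.integral_of_le hR, integral_rpow (Or.inl (by norm_num))]
    rw [Real.zero_rpow (by norm_num)]
    norm_num
    ring
  have h2 : ∫⁻ x in Set.Ioc 0 R, ENNReal.ofReal (|x| ^ (-(3 / 5) : ℝ))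
      = ENNReal.ofReal (5 / 2 * R ^ (2 / 5 : ℝ)) := by
    rw [← h1, ofReal_integral_eq_lintegral_ofReal h0]
    · refine setLIntegral_congr_fun measurableSet_Ioc fun x hx => ?_
      simp only [abs_of_pos hx.1]
    · filter_upwards [self_mem_ae_restrict measurableSet_Ioc] with x hx
      exact Real.rpow_nonneg hx.1.le _
  have h3 : ∫⁻ x in Set.Ico (-R) 0, ENNReal.ofReal (|x| ^ (-(3 / 5) : ℝ))
      = ENNReal.ofReal (5 / 2 * R ^ (2 / 5 : ℝ)) := by
    rw [← h2, ← (Measure.measurePreserving_neg (volume : Measure ℝ)).setLIntegral_comp_preimage_emb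
      (MeasurableEquiv.neg ℝ).measurableEmbedding]
    simp
  have hsub : {ξ : ℝ | |ξ| ≤ R} ⊆ (Set.Ico (-R) 0 ∪ Set.Ioc 0 R) ∪ {0} := by
    intro x hx
    have := abs_le.1 (show |x| ≤ R from hx)
    rcases lt_trichotomy x 0 with h | h | h
    · exact Or.inl (Or.inl ⟨this.1, h⟩)
    · exact Or.inr h
    · exact Or.inl (Or.inr ⟨h, this.2⟩)
  calc _ ≤ _ := lintegral_mono_set hsub
    _ ≤ _ := lintegral_union_le _ _ _
    _ ≤ _ := add_le_add_left (lintegral_union_le _ _ _) _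
    _ = _ := by
      rw [h2, h3]
      simp only [Measure.restrict_singleton, Real.volume_singleton, zero_smul,
        lintegral_zero_measure, add_zero]
      rw [← ENNReal.ofReal_add (by positivity) (by positivity)]
      congr 1; ring

lemma memLp_fourier_of_lintegral_lt_top {w : ℝ → ℂ} (hw : Integrable w)
    (hH : ∫⁻ ξ, ‖ξ‖ₑ * ‖𝓕 w ξ‖ₑ ^ 2 < ∞) : MemLp (𝓕 w) 2 := by
  have hc := continuous_fourier_of_integrable hw
  refine ⟨hc.aestronglyMeasurable, ?_⟩
  rw [eLpNorm_lt_top_iff_lintegral_rpow_enorm_lt_top (by norm_num) (by norm_num)]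
  set A := ∫ x, ‖w x‖
  have hb : ∀ ξ, ‖𝓕 w ξ‖ₑ ^ (2 : ℝ≥0∞).toReal
      ≤ (Set.Icc (-1 : ℝ) 1).indicator (fun _ => ENNReal.ofReal A ^ 2) ξ
        + ‖ξ‖ₑ * ‖𝓕 w ξ‖ₑ ^ 2 := by
    intro ξ
    simp only [ENNReal.toReal_ofNat, ENNReal.rpow_ofNat]
    by_cases h : ξ ∈ Set.Icc (-1 : ℝ) 1
    · rw [Set.indicator_of_mem h]
      refine le_trans ?_ le_self_add
      gcongr
      rw [← ofReal_norm]
      exact ENNReal.ofReal_le_ofReal (norm_fourier_le_integral_norm w ξ)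
    · rw [Set.indicator_of_notMem h, zero_add]
      refine le_mul_of_one_le_left' ?_
      rw [← ofReal_norm, ENNReal.one_le_ofReal, Real.norm_eq_abs]
      by_contra! hlt
      exact h ⟨(abs_lt.1 hlt).1.le, (abs_lt.1 hlt).2.le⟩
  refine (lintegral_mono hb).trans_lt ?_
  rw [lintegral_add_left (measurable_const.indicator measurableSet_Icc)]
  refine ENNReal.add_lt_top.2 ⟨?_, hH⟩
  rw [lintegral_indicator measurableSet_Icc, setLIntegral_const]
  exact ENNReal.mul_lt_top (by finiteness) (by simp)

/-- The level sets of `w` are controlled by the high frequencies of `w`: the frequencies `ξ` with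
`6 q |ξ|^(1/5) ≤ l` contribute at most `l / 2` to `w`, by inversion of the Fourier transform. -/
lemma volume_level_set_le {w : ℝ → ℂ} (hw : Integrable w) (hW : MemLp (𝓕 w) 2) {q : ℝ}
    (hq : 0 < q) (hN : ∫⁻ ξ, ENNReal.ofReal (|ξ| ^ (3 / 5 : ℝ)) * ‖𝓕 w ξ‖ₑ ^ 2
      ≤ ENNReal.ofReal (q ^ 2)) {l : ℝ} (hl : 0 < l) :
    ENNReal.ofReal (l ^ 2) * volume {x | l < ‖w x‖}
      ≤ 4 * ∫⁻ ξ in {ξ : ℝ | l < 6 * q * |ξ| ^ (1 / 5 : ℝ)}, ‖𝓕 w ξ‖ₑ ^ 2 := by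
  set S : Set ℝ := {ξ : ℝ | l < 6 * q * |ξ| ^ (1 / 5 : ℝ)} with hS
  have hSm : MeasurableSet S := measurableSet_lt (by fun_prop) (by fun_prop)
  have hc := continuous_fourier_of_integrable hw
  have hlowint : ∫⁻ ξ in Sᶜ, ‖𝓕 w ξ‖ₑ ≤ ENNReal.ofReal (l / 2) := by
    have hSc : Sᶜ ⊆ {ξ : ℝ | |ξ| ≤ (l / (6 * q)) ^ (5 : ℝ)} := by
      intro ξ hξ
      have h1 : |ξ| ^ (1 / 5 : ℝ) ≤ l / (6 * q) := by
        rw [le_div_iff₀ (by positivity)]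
        have : ¬ (l < 6 * q * |ξ| ^ (1 / 5 : ℝ)) := hξ
        linarith
      have h2 := Real.rpow_le_rpow (by positivity) h1 (by norm_num : (0 : ℝ) ≤ 5)
      rw [← Real.rpow_mul (abs_nonneg ξ)] at h2
      simpa using h2
    -- Young's inequality with weight `6 q² / l`
    have hpt : ∀ ξ : ℝ, ξ ≠ 0 → ‖𝓕 w ξ‖ₑ ≤
        ENNReal.ofReal (3 * q ^ 2 / l) * ENNReal.ofReal (|ξ| ^ (-(3 / 5) : ℝ))
        + ENNReal.ofReal (l / (12 * q ^ 2)) *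
          (ENNReal.ofReal (|ξ| ^ (3 / 5 : ℝ)) * ‖𝓕 w ξ‖ₑ ^ 2) := by
      intro ξ hξ
      have hp : 0 < |ξ| ^ (3 / 5 : ℝ) := Real.rpow_pos_of_pos (abs_pos.2 hξ) _
      rw [← ofReal_norm, ← ENNReal.ofReal_pow (norm_nonneg _),
        ← ENNReal.ofReal_mul (by positivity), ← ENNReal.ofReal_mul (by positivity),
        ← ENNReal.ofReal_mul (by positivity), ← ENNReal.ofReal_add (by positivity) (by positivity)]
      refine ENNReal.ofReal_le_ofReal ?_
      rw [Real.rpow_neg (abs_nonneg _)]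
      set z := ‖𝓕 w ξ‖
      set p := |ξ| ^ (3 / 5 : ℝ)
      have : 3 * q ^ 2 / l * p⁻¹ + l / (12 * q ^ 2) * (p * z ^ 2) - z
          = (6 * q ^ 2 - l * p * z) ^ 2 / (12 * q ^ 2 * l * p) := by
        field_simp
        ring
      have h2 : 0 ≤ (6 * q ^ 2 - l * p * z) ^ 2 / (12 * q ^ 2 * l * p) := by positivity
      linarith
    have hae : ∀ᵐ ξ ∂(volume.restrict Sᶜ), ξ ≠ (0 : ℝ) :=
      ae_restrict_of_ae (by simp [ae_iff])
    calc _ ≤ ∫⁻ ξ in Sᶜ, (ENNReal.ofReal (3 * q ^ 2 / l) * ENNReal.ofReal (|ξ| ^ (-(3 / 5) : ℝ))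
        + ENNReal.ofReal (l / (12 * q ^ 2)) *
          (ENNReal.ofReal (|ξ| ^ (3 / 5 : ℝ)) * ‖𝓕 w ξ‖ₑ ^ 2)) :=
          lintegral_mono_ae (hae.mono fun ξ hξ => hpt ξ hξ)
      _ = ENNReal.ofReal (3 * q ^ 2 / l) * (∫⁻ ξ in Sᶜ, ENNReal.ofReal (|ξ| ^ (-(3 / 5) : ℝ)))
          + ENNReal.ofReal (l / (12 * q ^ 2)) *
          ∫⁻ ξ in Sᶜ, (ENNReal.ofReal (|ξ| ^ (3 / 5 : ℝ)) * ‖𝓕 w ξ‖ₑ ^ 2) := by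
          rw [lintegral_add_left (by fun_prop), lintegral_const_mul' _ _ (by finiteness),
            lintegral_const_mul' _ _ (by finiteness)]
      _ ≤ ENNReal.ofReal (3 * q ^ 2 / l)
            * ENNReal.ofReal (5 * ((l / (6 * q)) ^ (5 : ℝ)) ^ (2 / 5 : ℝ))
          + ENNReal.ofReal (l / (12 * q ^ 2)) * ENNReal.ofReal (q ^ 2) := by
          gcongr
          · exact (lintegral_mono_set hSc).trans (lintegral_abs_rpow_Icc_le (by positivity))
          · exact (setLIntegral_le_lintegral _ _).trans hN
      _ = _ := by
          rw [← Real.rpow_mul (by positivity), ← ENNReal.ofReal_mul (by positivity),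
            ← ENNReal.ofReal_mul (by positivity), ← ENNReal.ofReal_add (by positivity)
            (by positivity)]
          congr 1
          norm_num
          field_simp
          norm_num
  have hlow : MemLp (Sᶜ.indicator (𝓕 w)) 2 := hW.indicator hSm.compl
  have hhigh : MemLp (S.indicator (𝓕 w)) 2 := hW.indicator hSm
  have hdec : (hW.toLp : L2R) = hlow.toLp + hhigh.toLp := by
    rw [← MemLp.toLp_add]
    congr 1
    rw [add_comm, Set.indicator_self_add_compl]
  have hinv := fourierInv_toLp_fourier_ae_eq hw hW
  rw [hdec, FourierTransform.fourierInv_add] at hinv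
  have hlen : ∫⁻ ξ, ‖(hlow.toLp : L2R) ξ‖ₑ ≤ ENNReal.ofReal (l / 2) := by
    refine le_trans (le_of_eq ?_) hlowint
    rw [← lintegral_indicator hSm.compl]
    refine lintegral_congr_ae ?_
    filter_upwards [hlow.coeFn_toLp] with ξ hξ
    rw [hξ, enorm_indicator_eq_indicator_enorm]
  have hli : Integrable (hlow.toLp : L2R) :=
    ⟨Lp.aestronglyMeasurable _, hlen.trans_lt (by finiteness)⟩
  have hlb : ∫ ξ, ‖(hlow.toLp : L2R) ξ‖ ≤ l / 2 := by
    rw [integral_norm_eq_lintegral_enorm (Lp.aestronglyMeasurable _)]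
    exact ENNReal.toReal_le_of_le_ofReal (by positivity) hlen
  set gh : L2R := 𝓕⁻ (hhigh.toLp : L2R) with hgh
  have hsub : volume {x | l < ‖w x‖} ≤ volume {x | ENNReal.ofReal (l / 2) ≤ ‖gh x‖ₑ} := by
    refine measure_mono_ae ?_
    filter_upwards [hinv, Lp.coeFn_add (𝓕⁻ (hlow.toLp : L2R) : L2R) gh,
      norm_fourierInv_L2_le _ hli] with x h1 h2 h3 h4
    rw [h2, Pi.add_apply] at h1
    have h4' : l < ‖w x‖ := h4
    rw [← h1] at h4'
    have h5 := norm_add_le ((𝓕⁻ (hlow.toLp : L2R) : L2R) x) (gh x)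
    change ENNReal.ofReal (l / 2) ≤ ‖gh x‖ₑ
    rw [← ofReal_norm]
    refine ENNReal.ofReal_le_ofReal ?_
    linarith
  have hcheb := mul_meas_ge_le_lintegral₀ (μ := (volume : Measure ℝ))
    (f := fun x => ‖gh x‖ₑ ^ 2) ((Lp.aestronglyMeasurable gh).enorm.pow_const 2)
    (ENNReal.ofReal (l / 2) ^ 2)
  have hset : {x | ENNReal.ofReal (l / 2) ^ 2 ≤ ‖gh x‖ₑ ^ 2}
      = {x | ENNReal.ofReal (l / 2) ≤ ‖gh x‖ₑ} := by
    ext x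
    exact (ENNReal.pow_right_strictMono two_ne_zero).le_iff_le
  have hpl : ∫⁻ x, ‖gh x‖ₑ ^ 2 = ∫⁻ ξ in S, ‖𝓕 w ξ‖ₑ ^ 2 := by
    have e1 := lintegral_enorm_sq_L2
    have e2 : ‖gh‖ₑ = ‖(hhigh.toLp : L2R)‖ₑ := by
      rw [← ofReal_norm, ← ofReal_norm, hgh, ← Lp.norm_fourier_eq,
        FourierTransform.fourier_fourierInv_eq]
    rw [e1, e2, ← e1, ← lintegral_indicator hSm]
    refine lintegral_congr_ae ?_
    filter_upwards [hhigh.coeFn_toLp] with ξ hξ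
    rw [hξ, enorm_indicator_eq_indicator_enorm]
    by_cases h : ξ ∈ S <;> simp [h]
  rw [hset, hpl] at hcheb
  calc ENNReal.ofReal (l ^ 2) * volume {x | l < ‖w x‖}
      = 4 * (ENNReal.ofReal (l / 2) ^ 2 * volume {x | l < ‖w x‖}) := by
        rw [← mul_assoc, ← ENNReal.ofReal_pow (by positivity),
          ← ENNReal.ofReal_ofNat 4, ← ENNReal.ofReal_mul (by norm_num)]
        congr 2
        ring
    _ ≤ 4 * (ENNReal.ofReal (l / 2) ^ 2 * volume {x | ENNReal.ofReal (l / 2) ≤ ‖gh x‖ₑ}) := by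
        gcongr
    _ ≤ _ := by gcongr

/-- The embedding of the homogeneous Sobolev space of order `3/10` into `L⁵`, by the layer cake
formula. -/
lemma lintegral_pow_five_le {w : ℝ → ℂ} (hw : Integrable w) (hW : MemLp (𝓕 w) 2) {q : ℝ}
    (hq : 0 < q) (hN : ∫⁻ ξ, ENNReal.ofReal (|ξ| ^ (3 / 5 : ℝ)) * ‖𝓕 w ξ‖ₑ ^ 2
      ≤ ENNReal.ofReal (q ^ 2)) :
    ∫⁻ x, ‖w x‖ₑ ^ 5 ≤ ENNReal.ofReal (1440 * q ^ 5) := by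
  have hc := continuous_fourier_of_integrable hw
  have hlayer := lintegral_rpow_eq_lintegral_meas_lt_mul (volume : Measure ℝ)
    (f := fun x => ‖w x‖) (Filter.Eventually.of_forall fun x => norm_nonneg _)
    hw.aestronglyMeasurable.norm.aemeasurable (p := 5) (by norm_num)
  have h1 : ∫⁻ x, ‖w x‖ₑ ^ 5 = ∫⁻ x, ENNReal.ofReal (‖w x‖ ^ (5 : ℝ)) := by
    refine lintegral_congr fun x => ?_
    rw [← ofReal_norm, ← ENNReal.ofReal_pow (norm_nonneg _)]
    norm_cast
  have hinner : ∀ ξ : ℝ, ∫⁻ t in Set.Ioi (0 : ℝ),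
      {p : ℝ × ℝ | p.1 < 6 * q * |p.2| ^ (1 / 5 : ℝ)}.indicator
        (fun p => ENNReal.ofReal (p.1 ^ 2)) (t, ξ)
      ≤ ENNReal.ofReal (72 * q ^ 3) * ENNReal.ofReal (|ξ| ^ (3 / 5 : ℝ)) := by
    intro ξ
    have hL : 0 ≤ 6 * q * |ξ| ^ (1 / 5 : ℝ) := by positivity
    have hi : IntegrableOn (fun t : ℝ => t ^ 2) (Set.Ioc 0 (6 * q * |ξ| ^ (1 / 5 : ℝ))) :=
      (continuous_pow 2).integrableOn_Ioc
    calc _ ≤ ∫⁻ t in Set.Ioi (0 : ℝ), (Set.Ioc 0 (6 * q * |ξ| ^ (1 / 5 : ℝ))).indicator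
          (fun t => ENNReal.ofReal (t ^ 2)) t := by
          refine setLIntegral_mono' measurableSet_Ioi fun t ht => ?_
          by_cases h : t < 6 * q * |ξ| ^ (1 / 5 : ℝ)
          · have ht' : 0 < t := ht
            simp [-one_div, h, h.le, ht']
          · simp [-one_div, Set.indicator_apply, h]
      _ ≤ ∫⁻ t in Set.Ioc 0 (6 * q * |ξ| ^ (1 / 5 : ℝ)), ENNReal.ofReal (t ^ 2) := by
          refine (setLIntegral_le_lintegral _ _).trans ?_
          rw [lintegral_indicator measurableSet_Ioc]
      _ = _ := by
          rw [← ofReal_integral_eq_lintegral_ofReal hi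
            (Filter.Eventually.of_forall fun t => sq_nonneg t),
            ← intervalIntegral.integral_of_le hL, integral_pow,
            ← ENNReal.ofReal_mul (by positivity)]
          congr 1
          have : |ξ| ^ (3 / 5 : ℝ) = (|ξ| ^ (1 / 5 : ℝ)) ^ 3 := by
            rw [← Real.rpow_natCast, ← Real.rpow_mul (abs_nonneg _)]; norm_num
          rw [this]
          norm_num
          ring
  have hSm : MeasurableSet {p : ℝ × ℝ | p.1 < 6 * q * |p.2| ^ (1 / 5 : ℝ)} :=
    measurableSet_lt (by fun_prop) (by fun_prop)
  rw [h1, hlayer]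
  calc ENNReal.ofReal 5 * ∫⁻ t in Set.Ioi (0 : ℝ),
        volume {x | t < ‖w x‖} * ENNReal.ofReal (t ^ ((5 : ℝ) - 1))
      ≤ ENNReal.ofReal 5 * ∫⁻ t in Set.Ioi (0 : ℝ), ∫⁻ ξ,
        4 * ({p : ℝ × ℝ | p.1 < 6 * q * |p.2| ^ (1 / 5 : ℝ)}.indicator
        (fun p => ENNReal.ofReal (p.1 ^ 2)) (t, ξ) * ‖𝓕 w ξ‖ₑ ^ 2) := by
        gcongr ENNReal.ofReal 5 * ?_
        refine setLIntegral_mono' measurableSet_Ioi fun t ht => ?_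
        have ht : 0 < t := ht
        have hlev := volume_level_set_le hw hW hq hN ht
        have e1 : ENNReal.ofReal (t ^ ((5 : ℝ) - 1))
            = ENNReal.ofReal (t ^ 2) * ENNReal.ofReal (t ^ 2) := by
          rw [← ENNReal.ofReal_mul (by positivity)]
          congr 1
          norm_num
          ring
        rw [e1, mul_comm, mul_assoc]
        refine (mul_le_mul_right hlev _).trans (le_of_eq ?_)
        rw [lintegral_const_mul' _ _ (by finiteness), mul_left_comm,
          ← lintegral_indicator (measurableSet_lt (by fun_prop) (by fun_prop)),
          ← lintegral_const_mul' _ _ (by finiteness)]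
        congr 1
        refine lintegral_congr fun ξ => ?_
        by_cases h : t < 6 * q * |ξ| ^ (1 / 5 : ℝ)
        · simp [-one_div, h]
        · simp [-one_div, h]
    _ = ENNReal.ofReal 5 * ∫⁻ ξ, 4 * ((∫⁻ t in Set.Ioi (0 : ℝ),
        {p : ℝ × ℝ | p.1 < 6 * q * |p.2| ^ (1 / 5 : ℝ)}.indicator
        (fun p => ENNReal.ofReal (p.1 ^ 2)) (t, ξ)) * ‖𝓕 w ξ‖ₑ ^ 2) := by
        have hmeas : Measurable (fun p : ℝ × ℝ =>
            {p : ℝ × ℝ | p.1 < 6 * q * |p.2| ^ (1 / 5 : ℝ)}.indicator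
            (fun p => ENNReal.ofReal (p.1 ^ 2)) p) :=
          (by fun_prop : Measurable fun p : ℝ × ℝ => ENNReal.ofReal (p.1 ^ 2)).indicator hSm
        rw [lintegral_lintegral_swap]
        · congr 1
          refine lintegral_congr fun ξ => ?_
          rw [lintegral_const_mul' _ _ (by finiteness), lintegral_mul_const' _ _ (by finiteness)]
        · have : Measurable fun p : ℝ × ℝ => ‖𝓕 w p.2‖ₑ ^ 2 :=
            ((hc.comp continuous_snd).enorm.measurable).pow_const 2
          exact ((hmeas.mul this).const_mul 4).aemeasurable
    _ ≤ ENNReal.ofReal 5 * ∫⁻ ξ, 4 * (ENNReal.ofReal (72 * q ^ 3) *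
        ENNReal.ofReal (|ξ| ^ (3 / 5 : ℝ)) * ‖𝓕 w ξ‖ₑ ^ 2) := by
        gcongr with ξ
        exact hinner ξ
    _ = ENNReal.ofReal 5 * (4 * (ENNReal.ofReal (72 * q ^ 3) *
        ∫⁻ ξ, ENNReal.ofReal (|ξ| ^ (3 / 5 : ℝ)) * ‖𝓕 w ξ‖ₑ ^ 2)) := by
        simp_rw [mul_assoc (ENNReal.ofReal (72 * q ^ 3))]
        rw [lintegral_const_mul' _ _ (by finiteness), lintegral_const_mul' _ _ (by finiteness)]
    _ ≤ ENNReal.ofReal 5 * (4 * (ENNReal.ofReal (72 * q ^ 3) * ENNReal.ofReal (q ^ 2))) := by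
        gcongr
    _ = _ := by
        rw [← ENNReal.ofReal_mul (by positivity), ← ENNReal.ofReal_ofNat 4,
          ← ENNReal.ofReal_mul (by positivity), ← ENNReal.ofReal_mul (by positivity)]
        congr 1
        ring

/-- Interpolation of the homogeneous Sobolev norm of order `3/10` between the norm of order `1/2`
and the `L¹` norm, which bounds the Fourier transform. -/
lemma lintegral_abs_rpow_mul_fourier_sq_le {w : ℝ → ℂ} {k α : ℝ} (hk : 0 < k) (hα : 0 < α)
    (hwA : ∫ x, ‖w x‖ ≤ α ^ 5)
    (hH : ∫⁻ ξ, ‖ξ‖ₑ * ‖𝓕 w ξ‖ₑ ^ 2 ≤ ENNReal.ofReal (k ^ 10)) :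
    ∫⁻ ξ, ENNReal.ofReal (|ξ| ^ (3 / 5 : ℝ)) * ‖𝓕 w ξ‖ₑ ^ 2
      ≤ ENNReal.ofReal ((2 * (k ^ 4 * α)) ^ 2) := by
  -- the two bounds balance at the frequency `r`
  set r : ℝ := (k / α) ^ 5 with hr
  have hr0 : 0 < r := by positivity
  have hr35 : r ^ (3 / 5 : ℝ) = (k / α) ^ 3 := by
    rw [hr, ← Real.rpow_natCast, ← Real.rpow_mul (by positivity), ← Real.rpow_natCast]
    norm_num
  have hr25 : r ^ (-(2 / 5) : ℝ) = (α / k) ^ 2 := by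
    rw [hr, ← Real.rpow_natCast, ← Real.rpow_mul (by positivity), ← inv_div k α, inv_pow,
      ← Real.rpow_natCast (k / α) 2, ← Real.rpow_neg (by positivity)]
    norm_num
  have hpt : ∀ ξ : ℝ, ENNReal.ofReal (|ξ| ^ (3 / 5 : ℝ)) * ‖𝓕 w ξ‖ₑ ^ 2
      ≤ (Set.Icc (-r) r).indicator (fun _ => ENNReal.ofReal ((k / α) ^ 3 * (α ^ 5) ^ 2)) ξ
        + ENNReal.ofReal ((α / k) ^ 2) * (‖ξ‖ₑ * ‖𝓕 w ξ‖ₑ ^ 2) := by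
    intro ξ
    have hb : ‖𝓕 w ξ‖ ≤ α ^ 5 := (norm_fourier_le_integral_norm w ξ).trans hwA
    rw [← ofReal_norm (𝓕 w ξ), ← ENNReal.ofReal_pow (norm_nonneg _)]
    by_cases h : ξ ∈ Set.Icc (-r) r
    · rw [Set.indicator_of_mem h]
      refine le_trans ?_ le_self_add
      rw [← ENNReal.ofReal_mul (by positivity)]
      refine ENNReal.ofReal_le_ofReal ?_
      rw [← hr35]
      have : |ξ| ≤ r := abs_le.2 h
      gcongr
    · rw [Set.indicator_of_notMem h, zero_add, ← mul_assoc]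
      gcongr
      have h2 : r < |ξ| := by
        by_contra! hlt
        exact h (abs_le.1 hlt)
      rw [← ofReal_norm, ← ENNReal.ofReal_mul (by positivity)]
      refine ENNReal.ofReal_le_ofReal ?_
      rw [← hr25, Real.norm_eq_abs]
      have h3 : |ξ| ^ (3 / 5 : ℝ) = |ξ| ^ (-(2 / 5) : ℝ) * |ξ| := by
        rw [← Real.rpow_add_one (by linarith)]; norm_num
      rw [h3]
      gcongr ?_ * _
      exact Real.rpow_le_rpow_of_nonpos hr0 h2.le (by norm_num)
  calc _ ≤ _ := lintegral_mono hpt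
    _ = ENNReal.ofReal ((k / α) ^ 3 * (α ^ 5) ^ 2) * ENNReal.ofReal (2 * r)
        + ENNReal.ofReal ((α / k) ^ 2) * ∫⁻ ξ, ‖ξ‖ₑ * ‖𝓕 w ξ‖ₑ ^ 2 := by
      rw [lintegral_add_left (measurable_const.indicator measurableSet_Icc),
        lintegral_indicator measurableSet_Icc, setLIntegral_const, Real.volume_Icc,
        lintegral_const_mul' _ _ (by finiteness)]
      congr 3
      ring
    _ ≤ ENNReal.ofReal ((k / α) ^ 3 * (α ^ 5) ^ 2) * ENNReal.ofReal (2 * r)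
        + ENNReal.ofReal ((α / k) ^ 2) * ENNReal.ofReal (k ^ 10) := by gcongr
    _ = ENNReal.ofReal (3 * k ^ 8 * α ^ 2) := by
      rw [← ENNReal.ofReal_mul (by positivity), ← ENNReal.ofReal_mul (by positivity),
        ← ENNReal.ofReal_add (by positivity) (by positivity)]
      congr 1
      rw [hr]
      field_simp
      ring
    _ ≤ _ := by
      refine ENNReal.ofReal_le_ofReal ?_
      have : 0 ≤ k ^ 8 * α ^ 2 := by positivity
      nlinarith

/-- Gagliardo–Nirenberg inequality `‖w‖₅⁵ ≤ C ‖w‖⁴ ‖w‖₁`, where the first norm on the right is the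
homogeneous Sobolev norm of order `1/2`. -/
theorem lintegral_pow_five_le_of_integrable {w : ℝ → ℂ} (hw : Integrable w) :
    ∫⁻ x, ‖w x‖ₑ ^ 5
      ≤ 46080 * (∫⁻ ξ, ‖ξ‖ₑ * ‖𝓕 w ξ‖ₑ ^ 2) ^ 2 * ∫⁻ x, ‖w x‖ₑ := by
  set H := ∫⁻ ξ, ‖ξ‖ₑ * ‖𝓕 w ξ‖ₑ ^ 2 with hHdef
  have hzero : w =ᵐ[volume] 0 → ∫⁻ x, ‖w x‖ₑ ^ 5 = 0 := by
    intro h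
    rw [lintegral_eq_zero_iff' (hw.aestronglyMeasurable.enorm.pow_const 5)]
    filter_upwards [h] with x hx
    simp [hx]
  rcases eq_or_ne (∫⁻ x, ‖w x‖ₑ) 0 with hA0 | hA0
  · rw [lintegral_eq_zero_iff' hw.aestronglyMeasurable.enorm] at hA0
    rw [hzero (by filter_upwards [hA0] with x hx; simpa using hx)]
    exact zero_le
  rcases eq_or_ne H ∞ with hHt | hHt
  · rw [hHt]
    simp [ENNReal.top_mul hA0]
  have hW := memLp_fourier_of_lintegral_lt_top hw hHt.lt_top
  have hinv := fourierInv_toLp_fourier_ae_eq hw hW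
  have hc := continuous_fourier_of_integrable hw
  rcases eq_or_ne H 0 with hH0 | hH0
  · have hm : Measurable fun ξ : ℝ => ‖ξ‖ₑ * ‖𝓕 w ξ‖ₑ ^ 2 :=
      measurable_enorm.mul (hc.enorm.measurable.pow_const 2)
    rw [hHdef, lintegral_eq_zero_iff hm] at hH0
    have hW0 : hW.toLp (𝓕 w) = 0 := by
      rw [Lp.eq_zero_iff_ae_eq_zero]
      have hne : ∀ᵐ ξ : ℝ, ξ ≠ 0 := by simp [ae_iff]
      filter_upwards [hH0, hne, hW.coeFn_toLp] with ξ h1 h2 h3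
      rw [h3]
      simpa [h2] using h1
    rw [hW0, FourierTransform.fourierInv_zero] at hinv
    rw [hzero (hinv.symm.trans (Lp.coeFn_zero _ _ _))]
    exact zero_le
  have hAt : ∫⁻ x, ‖w x‖ₑ ≠ ∞ := hw.2.ne
  have hAe : ∫ x, ‖w x‖ = (∫⁻ x, ‖w x‖ₑ).toReal :=
    integral_norm_eq_lintegral_enorm hw.aestronglyMeasurable
  have hApos := ENNReal.toReal_pos hA0 hAt
  have hHpos := ENNReal.toReal_pos hH0 hHt
  set α : ℝ := (∫⁻ x, ‖w x‖ₑ).toReal ^ (1 / 5 : ℝ) with hα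
  set k : ℝ := H.toReal ^ (1 / 10 : ℝ) with hk
  have hα5 : α ^ 5 = (∫⁻ x, ‖w x‖ₑ).toReal := by
    rw [hα, ← Real.rpow_natCast, ← Real.rpow_mul hApos.le]; norm_num
  have hk10 : k ^ 10 = H.toReal := by
    rw [hk, ← Real.rpow_natCast, ← Real.rpow_mul hHpos.le]; norm_num
  have hαpos : 0 < α := Real.rpow_pos_of_pos hApos _
  have hkpos : 0 < k := Real.rpow_pos_of_pos hHpos _
  have hN := lintegral_abs_rpow_mul_fourier_sq_le hkpos hαpos (by rw [hα5, hAe])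
    (by rw [hk10, ENNReal.ofReal_toReal hHt])
  refine (lintegral_pow_five_le hw hW (by positivity) hN).trans (le_of_eq ?_)
  have : 1440 * (2 * (k ^ 4 * α)) ^ 5 = 46080 * (k ^ 10) ^ 2 * α ^ 5 := by ring
  rw [this, hk10, hα5, ENNReal.ofReal_mul (by positivity), ENNReal.ofReal_mul (by positivity),
    ENNReal.ofReal_pow (by positivity), ENNReal.ofReal_toReal hHt, ENNReal.ofReal_toReal hAt]
  norm_num

/-- The Gagliardo–Nirenberg inequality for the density `|v|²`. -/
lemma eLpNorm_ten_pow_five_le (v : L2R) :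
    eLpNorm v 10 volume ^ 5 ≤ 46080 * ‖v‖ₑ *
      ∫⁻ ξ, ‖ξ‖ₑ * ‖∫ η, (𝓕 v : L2R) (η + ξ) * (starRingEnd ℂ) ((𝓕 v : L2R) η)‖ₑ ^ 2 := by
  have h := lintegral_pow_five_le_of_integrable (integrable_mul_conj_self v)
  simp_rw [fourier_mul_conj_self] at h
  set H := ∫⁻ ξ, ‖ξ‖ₑ * ‖∫ η, (𝓕 v : L2R) (η + ξ) * (starRingEnd ℂ) ((𝓕 v : L2R) η)‖ₑ ^ 2
  have e : ∀ x, ‖v x * (starRingEnd ℂ) (v x)‖ₑ = ‖v x‖ₑ ^ 2 := fun x => by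
    rw [enorm_mul, RCLike.enorm_conj, sq]
  simp_rw [e, ← pow_mul] at h
  have e10 : ∫⁻ x, ‖v x‖ₑ ^ (2 * 5) = (eLpNorm v 10 volume ^ 5) ^ 2 := by
    rw [eLpNorm_eq_lintegral_rpow_enorm_toReal (by norm_num) (by norm_num)]
    simp only [ENNReal.toReal_ofNat, ENNReal.rpow_ofNat]
    rw [← pow_mul, ← ENNReal.rpow_natCast, ← ENNReal.rpow_mul]
    norm_num
  rw [lintegral_enorm_sq_L2, e10] at h
  have h2 : (eLpNorm v 10 volume ^ 5) ^ 2 ≤ (46080 * ‖v‖ₑ * H) ^ 2 := by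
    refine h.trans ?_
    calc 46080 * H ^ 2 * ‖v‖ₑ ^ 2 ≤ 46080 ^ 2 * H ^ 2 * ‖v‖ₑ ^ 2 := by gcongr; norm_num
      _ = _ := by ring
  exact (ENNReal.pow_right_strictMono two_ne_zero).le_iff_le.1 h2

end GagliardoNirenberg

/-! ### Measurable representatives -/

section MeasurableRepresentatives

open Filter Topology

noncomputable instance instMeasurableSpaceL2R : MeasurableSpace L2R := borel L2R

instance instBorelSpaceL2R : BorelSpace L2R := ⟨rfl⟩

noncomputable instance instMeasurableSpaceL10R : MeasurableSpace L10R := borel L10R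

instance instBorelSpaceL10R : BorelSpace L10R := ⟨rfl⟩

instance fact_two_ne_top : Fact ((2 : ℝ≥0∞) ≠ ∞) := ⟨by norm_num⟩

instance fact_ten_ne_top : Fact ((10 : ℝ≥0∞) ≠ ∞) := ⟨by norm_num⟩

/-- The average of `u` over the interval `[x, x + 1 / (n + 1)]`, written as an inner product. -/
noncomputable def rightAverage (n : ℕ) (u : L2R) (x : ℝ) : ℂ :=
  ((n : ℂ) + 1) * inner ℂ (indicatorConstLp 2
    (measurableSet_Icc (a := x) (b := x + 1 / ((n : ℝ) + 1)))
    (by simp : (volume (Set.Icc x (x + 1 / ((n : ℝ) + 1)))) ≠ ∞) (1 : ℂ)) u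

lemma rightAverage_eq (n : ℕ) (u : L2R) (x : ℝ) :
    rightAverage n u x = ((n : ℂ) + 1) * ∫ y in Set.Icc x (x + 1 / ((n : ℝ) + 1)), u y := by
  rw [rightAverage, L2.inner_indicatorConstLp_one]

lemma continuous_rightAverage (n : ℕ) : Continuous fun p : L2R × ℝ => rightAverage n p.1 p.2 := by
  refine continuous_const.mul (Continuous.inner ?_ continuous_fst)
  refine Continuous.comp (g := fun x : ℝ => indicatorConstLp 2
    (measurableSet_Icc (a := x) (b := x + 1 / ((n : ℝ) + 1)))
    (by simp : (volume (Set.Icc x (x + 1 / ((n : ℝ) + 1)))) ≠ ∞) (1 : ℂ)) ?_ continuous_snd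
  refine continuous_indicatorConstLp_set (by norm_num) fun x => ?_
  set δ := 1 / ((n : ℝ) + 1)
  have hb : ∀ y, volume (symmDiff (Set.Icc y (y + δ)) (Set.Icc x (x + δ)))
      ≤ ENNReal.ofReal (2 * |y - x|) + ENNReal.ofReal (2 * |y - x|) := by
    intro y
    have hsub : symmDiff (Set.Icc y (y + δ)) (Set.Icc x (x + δ))
        ⊆ Set.Icc (x - |y - x|) (x + |y - x|) ∪ Set.Icc (x + δ - |y - x|) (x + δ + |y - x|) := by
      intro z hz
      have h1 := le_abs_self (y - x)
      have h2 := neg_abs_le (y - x)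
      simp only [Set.mem_symmDiff, Set.mem_Icc, Set.mem_union] at hz ⊢
      grind
    refine (measure_mono hsub).trans ((measure_union_le _ _).trans (le_of_eq ?_))
    rw [Real.volume_Icc, Real.volume_Icc]
    congr 2 <;> ring
  have ht : Tendsto (fun y => ENNReal.ofReal (2 * |y - x|) + ENNReal.ofReal (2 * |y - x|))
      (𝓝 x) (𝓝 0) := by
    have h1 : Continuous fun y => ENNReal.ofReal (2 * |y - x|) :=
      ENNReal.continuous_ofReal.comp (by fun_prop)
    have : Continuous fun y => ENNReal.ofReal (2 * |y - x|) + ENNReal.ofReal (2 * |y - x|) :=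
      h1.add h1
    simpa using this.tendsto x
  exact tendsto_of_tendsto_of_tendsto_of_le_of_le tendsto_const_nhds ht (fun _ => zero_le) hb

/-- A representative of the class `u`, defined everywhere by Lebesgue differentiation. Unlike the
representative chosen by the coercion, it is jointly measurable in the class and the point. -/
noncomputable def lebesgueRep (u : L2R) (x : ℝ) : ℂ := limUnder atTop fun n => rightAverage n u x

lemma measurable_lebesgueRep : Measurable fun p : L2R × ℝ => lebesgueRep p.1 p.2 :=
  (StronglyMeasurable.limUnder fun n => (continuous_rightAverage n).stronglyMeasurable).measurable

lemma Measurable.lebesgueRep {α : Type*} [MeasurableSpace α] {h : α → L2R} {x : α → ℝ}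
    (hh : Measurable h) (hx : Measurable x) : Measurable fun a => lebesgueRep (h a) (x a) := by
  have := measurable_lebesgueRep.comp (hh.prodMk hx)
  simpa only [Function.comp_def] using this

lemma lebesgueRep_ae_eq (u : L2R) : lebesgueRep u =ᵐ[volume] u := by
  have hloc : LocallyIntegrable u := (Lp.memLp u).locallyIntegrable (by norm_num)
  filter_upwards [LocallyIntegrable.ae_hasDerivAt_integral hloc] with x hx
  refine Tendsto.limUnder_eq ?_
  have h1 := (hx x).tendsto_slope.comp (f := fun n : ℕ => x + 1 / ((n : ℝ) + 1)) (x := atTop)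
    (tendsto_nhdsWithin_iff.2 ⟨by
      simpa using (tendsto_const_nhds (x := x)).add
        (tendsto_one_div_add_atTop_nhds_zero_nat (𝕜 := ℝ)),
      Eventually.of_forall fun n => by
        have : (0 : ℝ) < 1 / ((n : ℝ) + 1) := by positivity
        simp only [Set.mem_compl_iff, Set.mem_singleton_iff]
        linarith⟩)
  refine h1.congr fun n => ?_
  have hpos : (0 : ℝ) ≤ 1 / ((n : ℝ) + 1) := by positivity
  rw [rightAverage_eq, Function.comp_apply, slope_def_module, intervalIntegral.integral_same,
    intervalIntegral.integral_of_le (by linarith), integral_Icc_eq_integral_Ioc]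
  simp

attribute [irreducible] lebesgueRep

lemma lintegral_enorm_restrict_le (u : L2R) (s : Set ℝ) :
    ∫⁻ x in s, ‖u x‖ₑ ≤ ‖u‖ₑ * volume s ^ (1 / 2 : ℝ) := by
  have h := eLpNorm_le_eLpNorm_mul_rpow_measure_univ (p := 1) (q := 2) (by norm_num)
    ((Lp.aestronglyMeasurable u).restrict (s := s))
  rw [eLpNorm_one_eq_lintegral_enorm] at h
  refine h.trans ?_
  rw [Lp.enorm_def]
  simp only [Measure.restrict_apply_univ, ENNReal.toReal_one, ENNReal.toReal_ofNat]
  norm_num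
  gcongr
  exact Measure.restrict_le_self

/-- A Bochner integral in `L²` is computed pointwise. -/
lemma coeFn_integral_ae_eq {α : Type*} [MeasurableSpace α] {μ : Measure α} [SigmaFinite μ]
    {h : α → L2R} (hm : Measurable h) (hi : Integrable h μ) :
    (∫ a, h a ∂μ : L2R) =ᵐ[volume] fun x => ∫ a, lebesgueRep (h a) x ∂μ := by
  have hrep : Measurable fun p : α × ℝ => lebesgueRep (h p.1) p.2 :=
    (hm.comp measurable_fst).lebesgueRep measurable_snd
  have hint : ∀ s : Set ℝ, volume s < ∞ →
      Integrable (fun p : α × ℝ => lebesgueRep (h p.1) p.2) (μ.prod (volume.restrict s)) := by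
    intro s hμs
    refine ⟨hrep.aestronglyMeasurable, ?_⟩
    rw [HasFiniteIntegral, lintegral_prod _ hrep.enorm.aemeasurable]
    have hle : ∀ a, ∫⁻ x in s, ‖lebesgueRep (h a) x‖ₑ ≤ ‖h a‖ₑ * volume s ^ (1 / 2 : ℝ) := by
      intro a
      refine le_trans (le_of_eq ?_) (lintegral_enorm_restrict_le (h a) s)
      refine lintegral_congr_ae (ae_restrict_of_ae ?_)
      filter_upwards [lebesgueRep_ae_eq (h a)] with x hx
      rw [hx]
    refine (lintegral_mono hle).trans_lt ?_
    rw [lintegral_mul_const' _ _ (by finiteness)]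
    exact ENNReal.mul_lt_top hi.2 (by finiteness)
  refine ae_eq_of_forall_setIntegral_eq_of_sigmaFinite ?_ ?_ ?_
  · intro s _ hμs
    refine ⟨(Lp.aestronglyMeasurable _).restrict, (lintegral_enorm_restrict_le _ s).trans_lt ?_⟩
    finiteness
  · intro s _ hμs
    exact (hint s hμs).integral_prod_right
  · intro s hs hμs
    rw [← L2.inner_indicatorConstLp_one (𝕜 := ℂ) hs hμs.ne]
    have hcomm := ContinuousLinearMap.integral_comp_comm
      (innerSL ℂ (indicatorConstLp 2 hs hμs.ne (1 : ℂ) : L2R)) hi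
    simp only [innerSL_apply_apply] at hcomm
    rw [← hcomm, ← integral_integral_swap (hint s hμs)]
    refine integral_congr_ae (Eventually.of_forall fun a => ?_)
    simp only
    rw [L2.inner_indicatorConstLp_one (𝕜 := ℂ) hs hμs.ne]
    refine integral_congr_ae (ae_restrict_of_ae ?_)
    filter_upwards [lebesgueRep_ae_eq (h a)] with x hx
    rw [hx]

lemma measurable_of_measurable_edist {α E : Type*} [MeasurableSpace α] [PseudoEMetricSpace E]
    [SecondCountableTopology E] [MeasurableSpace E] [BorelSpace E] {f : α → E}
    (h : ∀ c, Measurable fun a => edist (f a) c) : Measurable f := by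
  refine measurable_of_isOpen fun U hU => ?_
  have hball : ∀ x : U, ∃ r > 0, Metric.eball (x : E) r ⊆ U := fun x =>
    EMetric.isOpen_iff.1 hU x x.2
  choose r hr hrU using hball
  obtain ⟨T, hT, hTU⟩ := TopologicalSpace.isOpen_iUnion_countable
    (fun x : U => Metric.eball (x : E) (r x)) fun x => Metric.isOpen_eball
  have hU' : U = ⋃ x ∈ T, Metric.eball (x : E) (r x) := by
    rw [hTU]
    refine Set.Subset.antisymm (fun x hx => ?_) (Set.iUnion_subset hrU)
    exact Set.mem_iUnion.2 ⟨⟨x, hx⟩, Metric.mem_eball_self (hr _)⟩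
  rw [hU', Set.preimage_iUnion₂]
  exact MeasurableSet.biUnion hT fun x _ => measurableSet_lt (h x) measurable_const

open Classical in
/-- The class in `L¹⁰(ℝ)` of an element of `L²(ℝ)`, with value `0` if it is not in `L¹⁰(ℝ)`. -/
noncomputable def toL10 (u : L2R) : L10R := if h : MemLp u 10 volume then h.toLp else 0

lemma toL10_ae_eq {u : L2R} (h : eLpNorm u 10 volume < ∞) : toL10 u =ᵐ[volume] u := by
  have h' : MemLp u 10 volume := ⟨Lp.aestronglyMeasurable u, h⟩
  rw [toL10, dif_pos h']
  exact h'.coeFn_toLp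

lemma enorm_toL10_le (u : L2R) : ‖toL10 u‖ₑ ≤ eLpNorm u 10 volume := by
  rw [toL10]
  split_ifs with h
  · rw [Lp.enorm_toLp]
  · simp

lemma measurable_eLpNorm_sub_ten {g : ℝ → ℂ} (hg : Measurable g) :
    Measurable fun u : L2R => eLpNorm (fun x => u x - g x) 10 volume := by
  have h1 : ∀ u : L2R, eLpNorm (fun x => u x - g x) 10 volume
      = (∫⁻ x, ‖lebesgueRep u x - g x‖ₑ ^ 10) ^ (1 / 10 : ℝ) := by
    intro u
    rw [eLpNorm_eq_lintegral_rpow_enorm_toReal (by norm_num) (by norm_num)]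
    simp only [ENNReal.toReal_ofNat, ENNReal.rpow_ofNat]
    congr 1
    refine lintegral_congr_ae ?_
    filter_upwards [lebesgueRep_ae_eq u] with x hx
    rw [hx]
  simp_rw [h1]
  refine Measurable.pow_const (Measurable.lintegral_prod_right' (f := fun p : L2R × ℝ =>
    ‖lebesgueRep p.1 p.2 - g p.2‖ₑ ^ 10) ?_) _
  exact ((measurable_lebesgueRep.sub (hg.comp measurable_snd)).enorm).pow_const 10

lemma measurable_eLpNorm_ten : Measurable fun u : L2R => eLpNorm u 10 volume := by
  simpa using measurable_eLpNorm_sub_ten (g := fun _ => 0) measurable_const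

lemma measurable_toL10 : Measurable toL10 := by
  refine measurable_of_measurable_edist fun c => ?_
  obtain ⟨g, hg, hgc⟩ : ∃ g : ℝ → ℂ, Measurable g ∧ c =ᵐ[volume] g :=
    ⟨_, (Lp.aestronglyMeasurable c).aemeasurable.measurable_mk,
      (Lp.aestronglyMeasurable c).aemeasurable.ae_eq_mk⟩
  have heq : (fun u : L2R => edist (toL10 u) c) = fun u : L2R =>
      if eLpNorm (u : ℝ → ℂ) 10 volume < ∞ then
        eLpNorm (fun x => (u : ℝ → ℂ) x - g x) 10 volume else edist 0 c := by
    ext u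
    split_ifs with h
    · rw [Lp.edist_def]
      refine eLpNorm_congr_ae ?_
      filter_upwards [toL10_ae_eq h, hgc] with x h1 h2
      simp [h1, h2]
    · rw [toL10, dif_neg]
      exact fun h' => h h'.2
  rw [heq]
  exact Measurable.ite (measurableSet_lt measurable_eLpNorm_ten measurable_const)
    (measurable_eLpNorm_sub_ten hg) measurable_const

end MeasurableRepresentatives

/-! ### The Schrödinger group -/

section SchrodingerGroup

open Filter Topology

lemma schrodingerSymbol_add (a b ξ : ℝ) :
    schrodingerSymbol (a + b) ξ = schrodingerSymbol a ξ * schrodingerSymbol b ξ := by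
  rw [schrodingerSymbol, schrodingerSymbol, schrodingerSymbol, ← Complex.exp_add]
  congr 1
  push_cast
  ring

lemma continuous_schrodingerSymbol_uncurry :
    Continuous fun p : ℝ × ℝ => schrodingerSymbol p.1 p.2 := by
  unfold schrodingerSymbol
  fun_prop

lemma fourier_schrodingerGroup (b : ℝ) (u : L2R) :
    (𝓕 (schrodingerGroup b u) : L2R) = (memLp_schrodingerSymbol_mul b (𝓕 u)).toLp _ := by
  rw [schrodingerGroup, FourierTransform.fourier_fourierInv_eq]

lemma coeFn_fourier_schrodingerGroup (b : ℝ) (u : L2R) :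
    (𝓕 (schrodingerGroup b u) : L2R) =ᵐ[volume]
      fun ξ => schrodingerSymbol b ξ * (𝓕 u : L2R) ξ := by
  rw [fourier_schrodingerGroup]
  exact MemLp.coeFn_toLp _

lemma fourier_L2_injective {u v : L2R} (h : (𝓕 u : L2R) =ᵐ[volume] (𝓕 v : L2R)) : u = v :=
  (Lp.fourierTransformₗᵢ ℝ ℂ).injective (Lp.ext h)

lemma schrodingerGroup_add_apply (b : ℝ) (u v : L2R) :
    schrodingerGroup b (u + v) = schrodingerGroup b u + schrodingerGroup b v := by
  refine fourier_L2_injective ?_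
  rw [FourierTransform.fourier_add]
  have h := coeFn_fourier_schrodingerGroup b (u + v)
  rw [FourierTransform.fourier_add] at h
  filter_upwards [h, coeFn_fourier_schrodingerGroup b u, coeFn_fourier_schrodingerGroup b v,
    Lp.coeFn_add (𝓕 u : L2R) (𝓕 v : L2R),
    Lp.coeFn_add (𝓕 (schrodingerGroup b u) : L2R) (𝓕 (schrodingerGroup b v) : L2R)]
    with ξ h1 h2 h3 h4 h5
  rw [h1, h5, Pi.add_apply, h2, h3, h4, Pi.add_apply, mul_add]

lemma schrodingerGroup_smul_apply (b : ℝ) (c : ℂ) (u : L2R) :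
    schrodingerGroup b (c • u) = c • schrodingerGroup b u := by
  refine fourier_L2_injective ?_
  rw [FourierTransform.fourier_smul]
  have h := coeFn_fourier_schrodingerGroup b (c • u)
  rw [FourierTransform.fourier_smul] at h
  filter_upwards [h, coeFn_fourier_schrodingerGroup b u, Lp.coeFn_smul c (𝓕 u : L2R),
    Lp.coeFn_smul c (𝓕 (schrodingerGroup b u) : L2R)] with ξ h1 h2 h3 h4
  rw [h1, h4, Pi.smul_apply, h2, h3, Pi.smul_apply, smul_eq_mul, smul_eq_mul]
  ring

lemma norm_schrodingerGroup (b : ℝ) (u : L2R) : ‖schrodingerGroup b u‖ = ‖u‖ := by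
  rw [← Lp.norm_fourier_eq, ← Lp.norm_fourier_eq u, Lp.norm_def, Lp.norm_def]
  congr 1
  refine eLpNorm_congr_norm_ae ?_
  filter_upwards [coeFn_fourier_schrodingerGroup b u] with ξ h
  rw [h, norm_mul, norm_schrodingerSymbol, one_mul]

lemma schrodingerGroup_schrodingerGroup (a b : ℝ) (u : L2R) :
    schrodingerGroup a (schrodingerGroup b u) = schrodingerGroup (a + b) u := by
  refine fourier_L2_injective ?_
  filter_upwards [coeFn_fourier_schrodingerGroup a (schrodingerGroup b u),
    coeFn_fourier_schrodingerGroup b u, coeFn_fourier_schrodingerGroup (a + b) u] with ξ h1 h2 h3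
  rw [h1, h2, h3, schrodingerSymbol_add, mul_assoc]

/-- The Schrödinger group as a linear isometry of `L²`. -/
noncomputable def schrodingerIsometry (b : ℝ) : L2R →ₗᵢ[ℂ] L2R where
  toFun := schrodingerGroup b
  map_add' := schrodingerGroup_add_apply b
  map_smul' := schrodingerGroup_smul_apply b
  norm_map' := norm_schrodingerGroup b

lemma continuous_schrodingerGroup_left (u : L2R) : Continuous fun b => schrodingerGroup b u := by
  refine (Lp.fourierTransformₗᵢ ℝ ℂ).symm.continuous.comp
    (g := (Lp.fourierTransformₗᵢ ℝ ℂ).symm)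
    (f := fun b => (memLp_schrodingerSymbol_mul b (𝓕 u)).toLp _) ?_
  rw [continuous_iff_seqContinuous]
  intro b b₀ hb
  refine (Lp.tendsto_Lp_iff_tendsto_eLpNorm'' _
    (fun n => memLp_schrodingerSymbol_mul (b n) (𝓕 u)) _ _).2 ?_
  set g : L2R := 𝓕 u
  have h0 : Tendsto
      (fun n => ∫⁻ ξ, ‖schrodingerSymbol (b n) ξ * g ξ - schrodingerSymbol b₀ ξ * g ξ‖ₑ ^ 2)
      atTop (𝓝 (∫⁻ ξ : ℝ, (0 : ℝ≥0∞))) := by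
    refine tendsto_lintegral_of_dominated_convergence' (fun ξ => (2 * ‖g ξ‖ₑ) ^ 2) ?_ ?_ ?_ ?_
    · intro n
      exact (((memLp_schrodingerSymbol_mul _ g).1.sub
        (memLp_schrodingerSymbol_mul _ g).1).enorm).pow_const 2
    · intro n
      refine Eventually.of_forall fun ξ => ?_
      have hs : ∀ c : ℝ, ‖schrodingerSymbol c ξ‖ₑ = 1 := fun c => by
        rw [← ofReal_norm, norm_schrodingerSymbol, ENNReal.ofReal_one]
      simp only
      gcongr
      refine (enorm_sub_le).trans (le_of_eq ?_)
      rw [enorm_mul, enorm_mul, hs, hs, one_mul, two_mul]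
    · simp_rw [mul_pow]
      rw [lintegral_const_mul' _ _ (by finiteness), lintegral_enorm_sq_L2]
      finiteness
    · refine Eventually.of_forall fun ξ => ?_
      have hc : Continuous fun c =>
          ‖schrodingerSymbol c ξ * g ξ - schrodingerSymbol b₀ ξ * g ξ‖ₑ ^ 2 := by
        have : Continuous fun c : ℝ => schrodingerSymbol c ξ :=
          continuous_schrodingerSymbol_uncurry.comp (by fun_prop : Continuous fun c : ℝ => (c, ξ))
        fun_prop
      simpa [Function.comp_def] using (hc.tendsto b₀).comp hb
  rw [lintegral_zero] at h0
  have h1 := (ENNReal.continuous_rpow_const (y := 1 / 2)).tendsto 0 |>.comp h0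
  rw [ENNReal.zero_rpow_of_pos (by norm_num)] at h1
  refine h1.congr fun n => ?_
  rw [eLpNorm_eq_lintegral_rpow_enorm_toReal (by norm_num) (by norm_num)]
  simp

lemma continuous_schrodingerGroup : Continuous fun p : ℝ × L2R => schrodingerGroup p.1 p.2 :=
  continuous_prod_of_continuous_lipschitzWith' _ 1
    (fun b => (schrodingerIsometry b).lipschitz) continuous_schrodingerGroup_left

lemma MeasureTheory.Integrable.schrodingerGroup {α : Type*} [MeasurableSpace α] {μ : Measure α}
    (b : ℝ) {h : α → L2R} (hh : Integrable h μ) :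
    Integrable (fun a => schrodingerGroup b (h a)) μ :=
  (schrodingerIsometry b).toContinuousLinearMap.integrable_comp hh

lemma integral_schrodingerGroup {α : Type*} [MeasurableSpace α] {μ : Measure α} (b : ℝ)
    {h : α → L2R} (hh : Integrable h μ) :
    ∫ a, schrodingerGroup b (h a) ∂μ = schrodingerGroup b (∫ a, h a ∂μ) :=
  (schrodingerIsometry b).toContinuousLinearMap.integral_comp_comm hh

end SchrodingerGroup

/-! ### The time axis -/

section TimeAxis

open Filter Topology

lemma measurableEmbedding_coe_nnreal : MeasurableEmbedding ((↑) : ℝ≥0 → ℝ) :=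
  MeasurableEmbedding.subtype_coe measurableSet_Ici

lemma measurePreserving_coe_timeVolume :
    MeasurePreserving ((↑) : ℝ≥0 → ℝ) timeVolume (volume.restrict (Set.Ici 0)) := by
  refine ⟨measurable_coe_nnreal_real, ?_⟩
  rw [timeVolume, measurableEmbedding_coe_nnreal.map_comap]
  congr 1
  ext x
  exact ⟨fun ⟨y, hy⟩ => hy ▸ y.2, fun hx => ⟨⟨x, hx⟩, rfl⟩⟩

instance instSigmaFiniteTimeVolume : SigmaFinite timeVolume :=
  measurePreserving_coe_timeVolume.sigmaFinite

lemma timeVolume_singleton (t : ℝ≥0) : timeVolume {t} = 0 := by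
  rw [timeVolume, measurableEmbedding_coe_nnreal.comap_apply]
  simp

/-- The singularity `(t - m)^(-1/2)` has integral at most `2 T^(1/2)` over a time interval of
length `T`. -/
lemma lintegral_inv_sqrt_le (s T m : ℝ≥0) (hm : s ≤ m) :
    ∫⁻ t in Set.Ioc s (s + T), (if m ≤ t then ENNReal.ofReal ((t : ℝ) - m) ^ (-(1 / 2) : ℝ) else 0)
        ∂timeVolume ≤ 2 * ENNReal.ofReal T ^ (1 / 2 : ℝ) := by
  have h1 : ∀ t ∈ Set.Ioc s (s + T),
      (if m ≤ t then ENNReal.ofReal ((t : ℝ) - m) ^ (-(1 / 2) : ℝ) else 0)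
      ≤ (Set.Icc (m : ℝ) (m + T)).indicator
        (fun x : ℝ => ENNReal.ofReal (x - m) ^ (-(1 / 2) : ℝ)) t := by
    intro t ht
    split_ifs with h
    · rw [Set.indicator_of_mem]
      have h3 : (t : ℝ) ≤ s + T := by exact_mod_cast ht.2
      have h4 : (s : ℝ) ≤ m := by exact_mod_cast hm
      exact ⟨by exact_mod_cast h, by linarith⟩
    · exact zero_le
  have hf : Measurable fun x : ℝ => ENNReal.ofReal (x - m) ^ (-(1 / 2) : ℝ) := by fun_prop
  have h0 : IntegrableOn (fun x : ℝ => x ^ (-(1 / 2) : ℝ)) (Set.Ioc 0 T) :=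
    (intervalIntegrable_iff_integrableOn_Ioc_of_le T.coe_nonneg).1
      (intervalIntegral.intervalIntegrable_rpow' (by norm_num))
  calc _ ≤ ∫⁻ t in Set.Ioc s (s + T), (Set.Icc (m : ℝ) (m + T)).indicator
        (fun x : ℝ => ENNReal.ofReal (x - m) ^ (-(1 / 2) : ℝ)) t ∂timeVolume :=
        setLIntegral_mono' measurableSet_Ioc h1
    _ ≤ ∫⁻ t : ℝ≥0, (Set.Icc (m : ℝ) (m + T)).indicator
        (fun x : ℝ => ENNReal.ofReal (x - m) ^ (-(1 / 2) : ℝ)) t ∂timeVolume :=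
        setLIntegral_le_lintegral _ _
    _ = ∫⁻ x in Set.Ici (0 : ℝ), (Set.Icc (m : ℝ) (m + T)).indicator
        (fun x : ℝ => ENNReal.ofReal (x - m) ^ (-(1 / 2) : ℝ)) x :=
        measurePreserving_coe_timeVolume.lintegral_comp (hf.indicator measurableSet_Icc)
    _ ≤ ∫⁻ x in Set.Icc (m : ℝ) (m + T), ENNReal.ofReal (x - m) ^ (-(1 / 2) : ℝ) := by
        refine (setLIntegral_le_lintegral _ _).trans (le_of_eq ?_)
        rw [lintegral_indicator measurableSet_Icc]
    _ = ∫⁻ x in Set.Icc (0 : ℝ) T, ENNReal.ofReal x ^ (-(1 / 2) : ℝ) := by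
        have := (measurePreserving_sub_right volume (m : ℝ)).setLIntegral_comp_preimage_emb
          (MeasurableEquiv.subRight (m : ℝ)).measurableEmbedding
          (fun x => ENNReal.ofReal x ^ (-(1 / 2) : ℝ)) (Set.Icc (0 : ℝ) T)
        rw [← this]
        congr 2
        ext x
        simp [add_comm]
    _ = ∫⁻ x in Set.Ioc (0 : ℝ) T, ENNReal.ofReal (x ^ (-(1 / 2) : ℝ)) := by
        rw [restrict_Ioc_eq_restrict_Icc.symm]
        refine setLIntegral_congr_fun measurableSet_Ioc fun x hx => ?_
        rw [ENNReal.ofReal_rpow_of_pos hx.1]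
    _ = 2 * ENNReal.ofReal T ^ (1 / 2 : ℝ) := by
        rw [← ofReal_integral_eq_lintegral_ofReal h0]
        · rw [← intervalIntegral.integral_of_le T.coe_nonneg, integral_rpow (Or.inl (by norm_num)),
            Real.zero_rpow (by norm_num), ENNReal.ofReal_rpow_of_nonneg T.coe_nonneg (by norm_num),
            ← ENNReal.ofReal_ofNat 2, ← ENNReal.ofReal_mul (by norm_num)]
          congr 1
          norm_num
          ring
        · filter_upwards [self_mem_ae_restrict measurableSet_Ioc] with x hx
          exact Real.rpow_nonneg hx.1.le _

end TimeAxis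

/-! ### Predictable versions -/

section PredictableVersions

open Filter Topology

variable {Ω : Type*} {mΩ : MeasurableSpace Ω} {𝔽 : Filtration ℝ≥0 mΩ}

/-- The largest multiple of `1 / (n + 1)` strictly smaller than `t`, and `0` if `t = 0`. -/
noncomputable def leftGridPoint (n : ℕ) (t : ℝ≥0) : ℝ≥0 :=
  ((⌈t * (n + 1)⌉₊ - 1 : ℕ) : ℝ≥0) / (n + 1)

lemma leftGridPoint_le (n : ℕ) (t : ℝ≥0) : leftGridPoint n t ≤ t := by
  rw [leftGridPoint, div_le_iff₀ (by positivity)]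
  rcases Nat.eq_zero_or_pos ⌈t * (n + 1)⌉₊ with h | h
  · simp [h]
  · exact (Nat.lt_ceil.1 (Nat.sub_lt h one_pos)).le

lemma tendsto_leftGridPoint (t : ℝ≥0) : Tendsto (fun n => leftGridPoint n t) atTop (𝓝 t) := by
  have h2 : Tendsto (fun n : ℕ => (t : ℝ) - 1 / ((n : ℝ) + 1)) atTop (𝓝 (t : ℝ)) := by
    simpa using (tendsto_const_nhds (x := (t : ℝ))).sub
      (tendsto_one_div_add_atTop_nhds_zero_nat (𝕜 := ℝ))
  rw [← NNReal.tendsto_coe]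
  refine tendsto_of_tendsto_of_tendsto_of_le_of_le h2 tendsto_const_nhds (fun n => ?_)
    (fun n => by exact_mod_cast leftGridPoint_le n t)
  have h1 : t * ((n : ℝ≥0) + 1) ≤ ⌈t * (n + 1)⌉₊ := Nat.le_ceil _
  have h3 : (⌈t * (n + 1)⌉₊ : ℝ) ≤ ((⌈t * (n + 1)⌉₊ - 1 : ℕ) : ℝ) + 1 := by
    exact_mod_cast (by omega : ⌈t * ((n : ℝ≥0) + 1)⌉₊ ≤ ⌈t * ((n : ℝ≥0) + 1)⌉₊ - 1 + 1)
  have h1' : (t : ℝ) * ((n : ℝ) + 1) ≤ (⌈t * (n + 1)⌉₊ : ℝ) := by exact_mod_cast h1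
  simp only [leftGridPoint, NNReal.coe_div, NNReal.coe_natCast, NNReal.coe_add, NNReal.coe_one]
  rw [le_div_iff₀ (by positivity), sub_mul, one_div_mul_cancel (by positivity)]
  linarith

lemma isStronglyPredictable_leftGridPoint {E : Type*} [TopologicalSpace E]
    [TopologicalSpace.PseudoMetrizableSpace E] [SecondCountableTopology E]
    {X : ℝ≥0 → Ω → E} (hX : StronglyAdapted 𝔽 X) (n : ℕ) :
    IsStronglyPredictable 𝔽 fun t ω => X (leftGridPoint n t) ω := by
  borelize E
  suffices hmeas : Measurable[𝔽.predictable]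
      (Function.uncurry fun t ω => X (leftGridPoint n t) ω) from hmeas.stronglyMeasurable
  intro U hU
  have heq : (Function.uncurry fun t ω => X (leftGridPoint n t) ω) ⁻¹' U
      = ⋃ k : ℕ, {t : ℝ≥0 | ⌈t * (n + 1)⌉₊ - 1 = k} ×ˢ ((X ((k : ℝ≥0) / (n + 1))) ⁻¹' U) := by
    ext ⟨t, ω⟩
    simp [leftGridPoint]
  rw [heq]
  refine @MeasurableSet.iUnion _ _ 𝔽.predictable _ _ fun k => ?_
  have hA : MeasurableSet[𝔽 ((k : ℝ≥0) / (n + 1))] ((X ((k : ℝ≥0) / (n + 1))) ⁻¹' U) :=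
    (hX _).measurable hU
  have hIoc : Set.Ioc ((k : ℝ≥0) / (n + 1)) (((k : ℝ≥0) + 1) / (n + 1))
      = {t : ℝ≥0 | ⌈t * (n + 1)⌉₊ = k + 1} := by
    ext t
    have hp : (0 : ℝ≥0) < n + 1 := by positivity
    rw [Set.mem_Ioc, div_lt_iff₀ hp, le_div_iff₀ hp, ← Nat.lt_ceil]
    have : t * ((n : ℝ≥0) + 1) ≤ (k : ℝ≥0) + 1 ↔ ⌈t * ((n : ℝ≥0) + 1)⌉₊ ≤ k + 1 := by
      rw [Nat.ceil_le]; push_cast; rfl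
    rw [this]
    change _ ↔ ⌈t * ((n : ℝ≥0) + 1)⌉₊ = k + 1
    omega
  have h1 := @measurableSet_predictable_Ioc_prod _ _ _ _ _ 𝔽 _ (((k : ℝ≥0) + 1) / (n + 1)) _ hA
  rw [hIoc] at h1
  rcases Nat.eq_zero_or_pos k with rfl | hk
  · have h0 : MeasurableSet[𝔽 ⊥] ((X (((0 : ℕ) : ℝ≥0) / (n + 1))) ⁻¹' U) := by
      have e : ((0 : ℕ) : ℝ≥0) / (n + 1) = ⊥ := by simp
      rw [e]
      exact (hX ⊥).measurable hU
    have h2 := measurableSet_predictable_singleton_bot_prod h0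
    have hu : {t : ℝ≥0 | ⌈t * (n + 1)⌉₊ - 1 = 0}
        = {⊥} ∪ {t : ℝ≥0 | ⌈t * (n + 1)⌉₊ = 0 + 1} := by
      ext t
      have : t = 0 ↔ ⌈t * ((n : ℝ≥0) + 1)⌉₊ = 0 := by
        rw [Nat.ceil_eq_zero]
        simp
      simp only [bot_eq_zero', Set.mem_union, Set.mem_singleton_iff]
      rw [this]
      change ⌈t * ((n : ℝ≥0) + 1)⌉₊ - 1 = 0 ↔ _ ∨ ⌈t * ((n : ℝ≥0) + 1)⌉₊ = 0 + 1
      omega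
    rw [hu, Set.union_prod]
    exact @MeasurableSet.union _ 𝔽.predictable _ _ h2 h1
  · have hu : {t : ℝ≥0 | ⌈t * (n + 1)⌉₊ - 1 = k} = {t : ℝ≥0 | ⌈t * (n + 1)⌉₊ = k + 1} := by
      ext t
      change ⌈t * ((n : ℝ≥0) + 1)⌉₊ - 1 = k ↔ ⌈t * ((n : ℝ≥0) + 1)⌉₊ = k + 1
      omega
    rw [hu]
    exact h1

/-- The process of left limits of `X` along the grids of mesh `1 / (n + 1)`. It is a predictable
modification of an adapted process with almost surely left continuous paths. -/
noncomputable def leftLimitProcess {E : Type*} [TopologicalSpace E] [Nonempty E]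
    (X : ℝ≥0 → Ω → E) (t : ℝ≥0) (ω : Ω) : E :=
  limUnder atTop fun n => X (leftGridPoint n t) ω

lemma isStronglyPredictable_leftLimitProcess {E : Type*} [TopologicalSpace E] [Nonempty E]
    [TopologicalSpace.IsCompletelyMetrizableSpace E] [SecondCountableTopology E]
    {X : ℝ≥0 → Ω → E} (hX : StronglyAdapted 𝔽 X) :
    IsStronglyPredictable 𝔽 (leftLimitProcess X) :=
  @StronglyMeasurable.limUnder _ _ _ 𝔽.predictable _ _ _ _ _ _ _
    fun n => isStronglyPredictable_leftGridPoint hX n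

lemma predictable_le_prod : 𝔽.predictable ≤ (inferInstance : MeasurableSpace (ℝ≥0 × Ω)) :=
  measurableSpace_le_predictable_of_measurableSet
    (fun _ hA => (measurableSet_singleton _).prod (𝔽.le _ _ hA))
    (fun i _ hA => measurableSet_Ioi.prod (𝔽.le i _ hA))

lemma stronglyMeasurable_uncurry_of_isStronglyPredictable {E : Type*} [TopologicalSpace E]
    {X : ℝ≥0 → Ω → E} (hX : IsStronglyPredictable 𝔽 X) : StronglyMeasurable (Function.uncurry X) :=
  StronglyMeasurable.mono hX predictable_le_prod

/-- The primitive of a predictable process is adapted. -/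
lemma stronglyAdapted_setIntegral {E : Type*} [NormedAddCommGroup E] [NormedSpace ℝ E]
    {h : ℝ≥0 → Ω → E} (hh : IsStronglyPredictable 𝔽 h) (s : ℝ≥0) :
    StronglyAdapted 𝔽 fun t ω => ∫ σ in Set.Ioc s t, h σ ω ∂timeVolume := by
  intro t
  have hprog := hh.isStronglyProgressive t
  let mt : MeasurableSpace Ω := 𝔽 t
  have hmap : Measurable fun p : Ω × ℝ≥0 =>
      ((⟨min p.2 t, Set.mem_Iic.2 (min_le_right _ _)⟩ : Set.Iic t), p.1) :=
    ((measurable_snd.min measurable_const).subtype_mk).prodMk measurable_fst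
  have hmeas : StronglyMeasurable fun p : Ω × ℝ≥0 => h (min p.2 t) p.1 :=
    hprog.comp_measurable hmap
  have heq : (fun ω => ∫ σ in Set.Ioc s t, h σ ω ∂timeVolume)
      = fun ω => ∫ σ in Set.Ioc s t, h (min σ t) ω ∂timeVolume := by
    ext ω
    refine setIntegral_congr_fun measurableSet_Ioc fun σ hσ => ?_
    simp only [min_eq_left hσ.2]
  change StronglyMeasurable fun ω => ∫ σ in Set.Ioc s t, h σ ω ∂timeVolume
  rw [heq]
  exact hmeas.integral_prod_right

lemma leftLimitProcess_eq_of_continuous {E : Type*} [TopologicalSpace E] [T2Space E] [Nonempty E]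
    {X : ℝ≥0 → Ω → E} {ω : Ω} (h : Continuous fun t => X t ω) (t : ℝ≥0) :
    leftLimitProcess X t ω = X t ω :=
  ((h.tendsto t).comp (tendsto_leftGridPoint t)).limUnder_eq

lemma leftLimitProcess_setIntegral {E : Type*} [NormedAddCommGroup E] [NormedSpace ℝ E]
    {h : ℝ≥0 → Ω → E} {s t : ℝ≥0} {ω : Ω}
    (hi : IntegrableOn (fun σ => h σ ω) (Set.Ioc s t) timeVolume) :
    leftLimitProcess (fun t ω => ∫ σ in Set.Ioc s t, h σ ω ∂timeVolume) t ω
      = ∫ σ in Set.Ioc s t, h σ ω ∂timeVolume := by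
  refine Tendsto.limUnder_eq ?_
  simp_rw [← integral_indicator measurableSet_Ioc]
  rw [← integrable_indicator_iff measurableSet_Ioc] at hi
  refine tendsto_integral_of_dominated_convergence
    (fun σ => ‖(Set.Ioc s t).indicator (fun σ => h σ ω) σ‖) (fun n => ?_) hi.norm (fun n => ?_) ?_
  · have : (Set.Ioc s (leftGridPoint n t)).indicator (fun σ => h σ ω)
        = (Set.Ioc s (leftGridPoint n t)).indicator ((Set.Ioc s t).indicator fun σ => h σ ω) := by
      rw [Set.indicator_indicator, Set.inter_eq_left.2 (Set.Ioc_subset_Ioc_right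
        (leftGridPoint_le n t))]
    rw [this]
    exact hi.1.indicator measurableSet_Ioc
  · exact Eventually.of_forall fun σ => norm_indicator_le_of_subset
      (Set.Ioc_subset_Ioc_right (leftGridPoint_le n t)) _ _
  · have hne : ∀ᵐ σ ∂timeVolume, σ ≠ t := by
      rw [ae_iff]
      simpa using timeVolume_singleton t
    filter_upwards [hne] with σ hσ
    refine tendsto_const_nhds.congr' ?_
    rcases lt_or_gt_of_ne hσ with hlt | hgt
    · filter_upwards [(tendsto_leftGridPoint t).eventually (lt_mem_nhds hlt)] with n hn
      simp only [Set.indicator_apply, Set.mem_Ioc, hlt.le, le_of_lt hn]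
    · refine Eventually.of_forall fun n => ?_
      simp only [Set.indicator_apply, Set.mem_Ioc, not_le.2 hgt,
        not_le.2 ((leftGridPoint_le n t).trans_lt hgt)]

end PredictableVersions

/-! ### Quadrilinear estimates -/

section QuadrilinearEstimate

/-- The characteristic function of a centred Gaussian variable of variance `τ`, evaluated at
`8 π² ξ x`, the resonance function of four Schrödinger waves with frequencies `η₁ + ξ`, `η₁`,
`η₂ + ξ`, `η₂`, where `x = η₁ - η₂`. -/
noncomputable def resonanceKernel (τ ξ x : ℝ) : ℝ≥0∞ :=
  ENNReal.ofReal (Real.exp (-((8 * Real.pi ^ 2 * ξ * x) ^ 2 * τ / 2)))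

lemma measurable_resonanceKernel :
    Measurable fun p : ℝ × ℝ × ℝ => resonanceKernel p.1 p.2.1 p.2.2 := by
  unfold resonanceKernel
  fun_prop

@[fun_prop]
lemma Measurable.resonanceKernel {α : Type*} [MeasurableSpace α] {τ ξ x : α → ℝ}
    (hτ : Measurable τ) (hξ : Measurable ξ) (hx : Measurable x) :
    Measurable fun p => resonanceKernel (τ p) (ξ p) (x p) :=
  measurable_resonanceKernel.comp (f := fun p => (τ p, ξ p, x p)) (hτ.prodMk (hξ.prodMk hx))

lemma resonanceKernel_neg (τ ξ x : ℝ) : resonanceKernel τ ξ (-x) = resonanceKernel τ ξ x := by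
  rw [resonanceKernel, resonanceKernel]
  congr 4
  ring

lemma lintegral_resonanceKernel_le (τ ξ : ℝ) :
    ∫⁻ x, ‖ξ‖ₑ * resonanceKernel τ ξ x ≤ ENNReal.ofReal τ ^ (-(1 / 2) : ℝ) := by
  rcases le_or_gt τ 0 with hτ | hτ
  · rw [ENNReal.ofReal_of_nonpos hτ, ENNReal.zero_rpow_of_neg (by norm_num)]
    exact le_top
  rcases eq_or_ne ξ 0 with rfl | hξ
  · simp
  have hξ' : 0 < |ξ| := abs_pos.2 hξ
  set b : ℝ := (8 * Real.pi ^ 2 * ξ) ^ 2 * τ / 2 with hb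
  have hbpos : 0 < b := by positivity
  have he : ∀ x, resonanceKernel τ ξ x = ENNReal.ofReal (Real.exp (-b * x ^ 2)) := by
    intro x
    rw [resonanceKernel, hb]
    congr 2
    ring
  simp_rw [he]
  rw [lintegral_const_mul' _ _ (by finiteness), ← ofReal_integral_eq_lintegral_ofReal
    (integrable_exp_neg_mul_sq hbpos) (Filter.Eventually.of_forall fun x => (Real.exp_pos _).le),
    integral_gaussian, ← ofReal_norm, ← ENNReal.ofReal_mul (norm_nonneg _),
    ENNReal.ofReal_rpow_of_pos hτ, Real.norm_eq_abs]
  refine ENNReal.ofReal_le_ofReal ?_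
  have h1 : τ ^ (-(1 / 2) : ℝ) = √(1 / τ) := by
    rw [Real.sqrt_eq_rpow, one_div τ, Real.inv_rpow hτ.le, Real.rpow_neg hτ.le]
  rw [h1, ← Real.sqrt_sq hξ'.le, ← Real.sqrt_mul (by positivity)]
  refine Real.sqrt_le_sqrt ?_
  rw [sq_abs, hb, ← mul_div_assoc, div_le_div_iff₀ (by positivity) hτ]
  have hpi := Real.pi_gt_three
  have h3 : Real.pi * 2 ≤ 64 * Real.pi ^ 4 := by
    have : 1 ≤ Real.pi ^ 3 := one_le_pow₀ (by linarith)
    nlinarith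
  have h4 := mul_le_mul_of_nonneg_right h3 (by positivity : 0 ≤ ξ ^ 2 * τ / 2)
  nlinarith

/-- The `L²` norm of a function with values in `[0, ∞]`. -/
noncomputable def l2Norm (f : ℝ → ℝ≥0∞) : ℝ≥0∞ := (∫⁻ x, f x ^ 2) ^ (1 / 2 : ℝ)

lemma l2Norm_comp_add_right (f : ℝ → ℝ≥0∞) (ξ : ℝ) : l2Norm (fun x => f (x + ξ)) = l2Norm f := by
  rw [l2Norm, l2Norm, lintegral_add_right_eq_self (fun x => f x ^ 2) ξ]

lemma lintegral_mul_le_sqrt_mul_sqrt {X : Type*} [MeasurableSpace X] (μ : Measure X)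
    {w f g : X → ℝ≥0∞} (hw : Measurable w) (hf : Measurable f) (hg : Measurable g) :
    ∫⁻ x, w x * (f x * g x) ∂μ
      ≤ (∫⁻ x, w x * f x ^ 2 ∂μ) ^ (1 / 2 : ℝ) * (∫⁻ x, w x * g x ^ 2 ∂μ) ^ (1 / 2 : ℝ) := by
  have h := ENNReal.lintegral_mul_le_Lp_mul_Lq μ Real.HolderConjugate.two_two
    (f := fun x => w x ^ (1 / 2 : ℝ) * f x) (g := fun x => w x ^ (1 / 2 : ℝ) * g x)
    (by fun_prop) (by fun_prop)
  have e : ∀ x : X, ∀ y : ℝ≥0∞, (w x ^ (1 / 2 : ℝ) * y) ^ (2 : ℝ) = w x * y ^ 2 := fun x y => by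
    rw [ENNReal.mul_rpow_of_nonneg _ _ (by norm_num), ← ENNReal.rpow_mul]
    norm_num
  simp_rw [e] at h
  refine le_trans (le_of_eq (lintegral_congr fun x => ?_)) h
  have e2 : w x ^ (1 / 2 : ℝ) * w x ^ (1 / 2 : ℝ) = w x := by
    rw [← ENNReal.rpow_add_of_nonneg _ _ (by norm_num) (by norm_num)]
    norm_num
  calc w x * (f x * g x) = (w x ^ (1 / 2 : ℝ) * w x ^ (1 / 2 : ℝ)) * (f x * g x) := by rw [e2]
    _ = _ := by simp only [Pi.mul_apply]; ring

lemma lintegral_mul_le_l2Norm {f g : ℝ → ℝ≥0∞} (hf : Measurable f) (hg : Measurable g) :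
    ∫⁻ x, f x * g x ≤ l2Norm f * l2Norm g := by
  simpa [l2Norm] using lintegral_mul_le_sqrt_mul_sqrt volume (w := fun _ => 1)
    measurable_const hf hg

lemma lintegral_quadrilinear_le (ξ : ℝ) {f₁ f₂ f₃ f₄ : ℝ → ℝ≥0∞} (h₁ : Measurable f₁)
    (h₂ : Measurable f₂) (h₃ : Measurable f₃) (h₄ : Measurable f₄) :
    ∫⁻ η : ℝ × ℝ, (f₁ (η.1 + ξ) * f₂ η.1) * (f₃ (η.2 + ξ) * f₄ η.2)
      ≤ (l2Norm f₁ * l2Norm f₂) * (l2Norm f₃ * l2Norm f₄) := by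
  rw [Measure.volume_eq_prod, lintegral_prod_mul (f := fun x => f₁ (x + ξ) * f₂ x)
    (g := fun x => f₃ (x + ξ) * f₄ x) (by fun_prop) (by fun_prop)]
  have e : ∀ {f g : ℝ → ℝ≥0∞}, Measurable f → Measurable g →
      ∫⁻ x, f (x + ξ) * g x ≤ l2Norm f * l2Norm g := fun {f g} hf hg => by
    rw [← l2Norm_comp_add_right f ξ]
    exact lintegral_mul_le_l2Norm (by fun_prop) hg
  gcongr
  · exact e h₁ h₂
  · exact e h₃ h₄

lemma lintegral_translates_sq {f g : ℝ → ℝ≥0∞} (hf : Measurable f) (hg : Measurable g) :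
    ∫⁻ ξ, ∫⁻ η, (f (η + ξ) * g η) ^ 2 = l2Norm f ^ 2 * l2Norm g ^ 2 := by
  have e : ∀ f : ℝ → ℝ≥0∞, l2Norm f ^ 2 = ∫⁻ x, f x ^ 2 := fun f => by
    rw [l2Norm, ← ENNReal.rpow_natCast, ← ENNReal.rpow_mul]
    norm_num
  rw [lintegral_lintegral_swap (by fun_prop), e, e, mul_comm,
    ← lintegral_mul_const'' _ (by fun_prop)]
  refine lintegral_congr fun η => ?_
  simp_rw [mul_pow]
  rw [lintegral_mul_const _ (by fun_prop), mul_comm,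
    lintegral_add_left_eq_self (fun x => f x ^ 2) η]

/-- By the Cauchy–Schwarz inequality, a kernel `w ξ η₁ η₂` which is symmetric in `η₁` and `η₂` acts
like its integral in `η₂`. -/
lemma lintegral_quadrilinear_le_of_kernel {w : ℝ × ℝ × ℝ → ℝ≥0∞} (hw : Measurable w) {S : ℝ≥0∞}
    (hS : ∀ ξ η₁, ∫⁻ η₂, w (ξ, η₁, η₂) ≤ S) (hsymm : ∀ ξ η₁ η₂, w (ξ, η₂, η₁) = w (ξ, η₁, η₂))
    {f₁ f₂ f₃ f₄ : ℝ → ℝ≥0∞} (h₁ : Measurable f₁)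
    (h₂ : Measurable f₂) (h₃ : Measurable f₃) (h₄ : Measurable f₄) :
    ∫⁻ ξ : ℝ, ∫⁻ η : ℝ × ℝ, w (ξ, η) *
        ((f₁ (η.1 + ξ) * f₂ η.1) * (f₃ (η.2 + ξ) * f₄ η.2))
      ≤ S * ((l2Norm f₁ * l2Norm f₂) * (l2Norm f₃ * l2Norm f₄)) := by
  have hA : ∀ f g : ℝ → ℝ≥0∞, Measurable f → Measurable g →
      ∫⁻ p : ℝ × ℝ × ℝ, w p * (f (p.2.1 + p.1) * g p.2.1) ^ 2
        ≤ S * (l2Norm f * l2Norm g) ^ 2 := by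
    intro f g hf hg
    rw [Measure.volume_eq_prod, Measure.volume_eq_prod, lintegral_prod _ (by fun_prop)]
    have h1 : ∀ ξ : ℝ, ∫⁻ η : ℝ × ℝ, w (ξ, η) * (f (η.1 + ξ) * g η.1) ^ 2 ∂(volume.prod volume)
        ≤ S * ∫⁻ η, (f (η + ξ) * g η) ^ 2 := by
      intro ξ
      rw [lintegral_prod _ (by fun_prop), ← lintegral_const_mul _ (by fun_prop)]
      refine lintegral_mono fun η₁ => ?_
      simp only
      rw [lintegral_mul_const _ (by fun_prop)]
      gcongr
      exact hS ξ η₁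
    refine (lintegral_mono h1).trans (le_of_eq ?_)
    have hm : Measurable fun p : ℝ × ℝ => (f (p.2 + p.1) * g p.2) ^ 2 := by fun_prop
    rw [lintegral_const_mul _ hm.lintegral_prod_right', lintegral_translates_sq hf hg, mul_pow]
  have hB : ∀ f g : ℝ → ℝ≥0∞, Measurable f → Measurable g →
      ∫⁻ p : ℝ × ℝ × ℝ, w p * (f (p.2.2 + p.1) * g p.2.2) ^ 2
        ≤ S * (l2Norm f * l2Norm g) ^ 2 := by
    intro f g hf hg
    refine le_trans (le_of_eq ?_) (hA f g hf hg)
    have hmp : MeasurePreserving (Prod.map id Prod.swap : ℝ × ℝ × ℝ → ℝ × ℝ × ℝ)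
        volume volume := (MeasurePreserving.id volume).prod Measure.measurePreserving_swap
    rw [← hmp.lintegral_comp (by fun_prop)]
    refine lintegral_congr fun p => ?_
    simp only [Prod.map_fst, Prod.map_snd, id_eq, Prod.snd_swap]
    rw [show Prod.map id Prod.swap p = (p.1, p.2.2, p.2.1) from rfl, hsymm]
  have hroot : ∀ x y : ℝ≥0∞, x ≤ S * y ^ 2 → x ^ (1 / 2 : ℝ) ≤ S ^ (1 / 2 : ℝ) * y := by
    intro x y hxy
    refine (ENNReal.rpow_le_rpow hxy (by norm_num)).trans (le_of_eq ?_)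
    rw [ENNReal.mul_rpow_of_nonneg _ _ (by norm_num), ← ENNReal.rpow_natCast, ← ENNReal.rpow_mul]
    norm_num
  have hcs := lintegral_mul_le_sqrt_mul_sqrt (volume : Measure (ℝ × ℝ × ℝ)) hw
    (f := fun p => f₁ (p.2.1 + p.1) * f₂ p.2.1) (g := fun p => f₃ (p.2.2 + p.1) * f₄ p.2.2)
    (by fun_prop) (by fun_prop)
  rw [Measure.volume_eq_prod ℝ (ℝ × ℝ), lintegral_prod _ (by fun_prop)] at hcs
  rw [Measure.volume_eq_prod ℝ (ℝ × ℝ)] at hA hB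
  refine hcs.trans ((mul_le_mul' (hroot _ _ (hA f₁ f₂ h₁ h₂)) (hroot _ _ (hB f₃ f₄ h₃ h₄))).trans
    (le_of_eq ?_))
  have e2 : S ^ (1 / 2 : ℝ) * S ^ (1 / 2 : ℝ) = S := by
    rw [← ENNReal.rpow_add_of_nonneg _ _ (by norm_num) (by norm_num)]
    norm_num
  rw [mul_mul_mul_comm, e2]

/-- The quadrilinear estimate behind local smoothing: the kernel `|ξ| exp (-θ² τ / 2)`, where
`θ = 8 π² ξ (η₁ - η₂)`, has an integral in `η₁ - η₂` of size `τ^(-1/2)` independently of `ξ`. -/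
lemma lintegral_resonance_quadrilinear_le (τ : ℝ) {f₁ f₂ f₃ f₄ : ℝ → ℝ≥0∞} (h₁ : Measurable f₁)
    (h₂ : Measurable f₂) (h₃ : Measurable f₃) (h₄ : Measurable f₄) :
    ∫⁻ ξ : ℝ, ∫⁻ η : ℝ × ℝ, ‖ξ‖ₑ * resonanceKernel τ ξ (η.1 - η.2) *
        ((f₁ (η.1 + ξ) * f₂ η.1) * (f₃ (η.2 + ξ) * f₄ η.2))
      ≤ ENNReal.ofReal τ ^ (-(1 / 2) : ℝ)
        * ((l2Norm f₁ * l2Norm f₂) * (l2Norm f₃ * l2Norm f₄)) := by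
  refine lintegral_quadrilinear_le_of_kernel
    (w := fun p => ‖p.1‖ₑ * resonanceKernel τ p.1 (p.2.1 - p.2.2))
    ?_ (fun ξ η₁ => ?_) (fun ξ η₁ η₂ => ?_) h₁ h₂ h₃ h₄
  · fun_prop
  · simp only
    rw [lintegral_sub_left_eq_self (fun x => ‖ξ‖ₑ * resonanceKernel τ ξ x) η₁]
    exact lintegral_resonanceKernel_le τ ξ
  · simp only
    rw [← resonanceKernel_neg, neg_sub]

end QuadrilinearEstimate

/-! ### Averages of Brownian oscillations -/

section StochasticSmoothing

open Filter ComplexConjugate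

variable {Ω : Type*} {mΩ : MeasurableSpace Ω} {P : Measure Ω} {𝔽 : Filtration ℝ≥0 mΩ}
  {β : ℝ≥0 → Ω → ℝ}

/-- Averaging an oscillation of the Brownian path at time `t` against a variable known at time
`m ≤ t` gains the characteristic function of the increment after time `m`. -/
lemma enorm_integral_exp_brownian_mul_le [IsProbabilityMeasure P]
    (hβ : IsFilteredBrownian P 𝔽 β) {m t : ℝ≥0} (hmt : m ≤ t) (θ : ℝ) {G : Ω → ℂ}
    (hG : Measurable[𝔽 m] G) :
    ‖∫ ω, Complex.exp (-(Complex.I * ((θ * β t ω : ℝ) : ℂ))) * G ω ∂P‖ₑ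
      ≤ ENNReal.ofReal (Real.exp (-(θ ^ 2 * ((t : ℝ) - m) / 2))) * ∫⁻ ω, ‖G ω‖ₑ ∂P := by
  set D : Ω → ℝ := fun ω => β t ω - β m ω with hD
  set φ : ℝ → ℂ := fun x => Complex.exp (-(Complex.I * ((θ * x : ℝ) : ℂ))) with hφ
  have hφc : Continuous φ := by fun_prop
  have hφm : Measurable φ := hφc.measurable
  have hβm : Measurable[𝔽 m] (β m) := (hβ.adapted m).measurable
  have hDm : Measurable D := ((hβ.adapted t).measurable.mono (𝔽.le t) le_rfl).sub
    (hβm.mono (𝔽.le m) le_rfl)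
  have hYm : Measurable[𝔽 m] fun ω => φ (β m ω) * G ω := (hφm.comp hβm).mul hG
  have hind : IndepFun (fun ω => φ (D ω)) (fun ω => φ (β m ω) * G ω) P := by
    rw [IndepFun_iff_Indep]
    refine indep_of_indep_of_le_right
      (indep_of_indep_of_le_left (hβ.indep m t hmt) ?_) hYm.comap_le
    exact (hφm.comp (comap_measurable D)).comap_le
  have hsplit : ∀ ω, Complex.exp (-(Complex.I * ((θ * β t ω : ℝ) : ℂ))) * G ω
      = φ (D ω) * (φ (β m ω) * G ω) := by
    intro ω
    rw [← mul_assoc, hφ, hD]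
    simp only
    rw [← Complex.exp_add]
    congr 2
    push_cast
    ring
  have hchar : ∫ ω, φ (D ω) ∂P = Complex.exp (-((θ ^ 2 * ((t : ℝ) - m) / 2 : ℝ) : ℂ)) := by
    have hlaw := hβ.brownian.toIsPreBrownianReal.hasLaw_sub t m
    have hch := charFun_gaussianReal (μ := 0) (v := nndist (t : ℝ) m) (-θ)
    rw [charFun_apply_real] at hch
    have h1 := hlaw.integral_comp (f := fun x : ℝ => φ x) hφc.aestronglyMeasurable
    calc ∫ ω, φ (D ω) ∂P = ∫ x, φ x ∂(gaussianReal 0 (nndist (t : ℝ) m)) := h1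
      _ = ∫ x : ℝ, Complex.exp (((-θ : ℝ) : ℂ) * x * Complex.I)
            ∂(gaussianReal 0 (nndist (t : ℝ) m)) := by
          refine integral_congr_ae (Eventually.of_forall fun x => ?_)
          simp only [hφ]
          congr 1
          push_cast
          ring
      _ = _ := by
          rw [hch]
          congr 1
          have h2 : ((nndist (t : ℝ) m : ℝ≥0) : ℂ) = (((t : ℝ) - m : ℝ) : ℂ) := by
            have h3 : dist (t : ℝ) m = (t : ℝ) - m := by
              rw [Real.dist_eq, abs_of_nonneg (sub_nonneg.2 (by exact_mod_cast hmt))]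
            rw [← h3, ← coe_nndist]
          rw [h2]
          push_cast
          ring
  have hnorm : ∀ x, ‖φ x‖ₑ = 1 := fun x => by
    rw [← ofReal_norm, hφ]
    simp only
    rw [← mul_neg, ← Complex.ofReal_neg, mul_comm, Complex.norm_exp_ofReal_mul_I,
      ENNReal.ofReal_one]
  simp_rw [hsplit]
  rw [hind.integral_fun_mul_eq_mul_integral (hφm.comp hDm).aestronglyMeasurable
    (hYm.mono (𝔽.le m) le_rfl).aestronglyMeasurable, enorm_mul, hchar]
  gcongr
  · rw [← ofReal_norm, ← Complex.ofReal_neg, Complex.norm_exp_ofReal]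
  · refine (enorm_integral_le_lintegral_enorm _).trans (le_of_eq (lintegral_congr fun ω => ?_))
    rw [enorm_mul, hnorm, one_mul]

/-- The latest of four times. -/
def latest (σ : (ℝ≥0 × ℝ≥0) × (ℝ≥0 × ℝ≥0)) : ℝ≥0 := max (max σ.1.1 σ.1.2) (max σ.2.1 σ.2.2)

@[fun_prop]
lemma measurable_latest : Measurable latest := by
  unfold latest
  fun_prop

/-- The quadruples of times in `(s, t]`. -/
def timeBox (s t : ℝ≥0) : Set ((ℝ≥0 × ℝ≥0) × (ℝ≥0 × ℝ≥0)) :=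
  (Set.Ioc s t ×ˢ Set.Ioc s t) ×ˢ (Set.Ioc s t ×ˢ Set.Ioc s t)

lemma measurableSet_timeBox (s t : ℝ≥0) : MeasurableSet (timeBox s t) :=
  (measurableSet_Ioc.prod measurableSet_Ioc).prod (measurableSet_Ioc.prod measurableSet_Ioc)

lemma mem_timeBox_iff {s t : ℝ≥0} {σ : (ℝ≥0 × ℝ≥0) × (ℝ≥0 × ℝ≥0)} :
    σ ∈ timeBox s t ↔ ((s < σ.1.1 ∧ σ.1.1 ≤ t) ∧ (s < σ.1.2 ∧ σ.1.2 ≤ t)) ∧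
      ((s < σ.2.1 ∧ σ.2.1 ≤ t) ∧ (s < σ.2.2 ∧ σ.2.2 ≤ t)) := Iff.rfl

lemma latest_le_of_mem_timeBox {s t : ℝ≥0} {σ : (ℝ≥0 × ℝ≥0) × (ℝ≥0 × ℝ≥0)}
    (h : σ ∈ timeBox s t) : latest σ ≤ t := by
  rw [mem_timeBox_iff] at h
  exact max_le (max_le h.1.1.2 h.1.2.2) (max_le h.2.1.2 h.2.2.2)

lemma le_latest_of_mem_timeBox {s t : ℝ≥0} {σ : (ℝ≥0 × ℝ≥0) × (ℝ≥0 × ℝ≥0)}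
    (h : σ ∈ timeBox s t) : s ≤ latest σ :=
  (mem_timeBox_iff.1 h).1.1.1.le.trans ((le_max_left _ _).trans (le_max_left _ _))

/-- Lebesgue measure on quadruples of times. -/
noncomputable def timeVolume4 : Measure ((ℝ≥0 × ℝ≥0) × (ℝ≥0 × ℝ≥0)) :=
  (timeVolume.prod timeVolume).prod (timeVolume.prod timeVolume)

instance instSigmaFiniteTimeVolume4 : SigmaFinite timeVolume4 := by
  unfold timeVolume4
  infer_instance

lemma timeVolume4_restrict (s t : ℝ≥0) : timeVolume4.restrict (timeBox s t) =
    ((timeVolume.restrict (Set.Ioc s t)).prod (timeVolume.restrict (Set.Ioc s t))).prod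
      ((timeVolume.restrict (Set.Ioc s t)).prod (timeVolume.restrict (Set.Ioc s t))) := by
  rw [timeVolume4, timeBox, ← Measure.prod_restrict, ← Measure.prod_restrict]

/-- The product of the amplitudes `a` of four waves at the times `σ`, with frequencies as in the
expansion of the squared modulus of an autocorrelation at `ξ`. -/
noncomputable def fourWave (a : (ℝ≥0 × Ω) × ℝ → ℂ) (ξ : ℝ) (ω : Ω)
    (σ : (ℝ≥0 × ℝ≥0) × (ℝ≥0 × ℝ≥0)) (η : ℝ × ℝ) : ℂ :=
  (a ((σ.1.1, ω), η.1 + ξ) * conj (a ((σ.1.2, ω), η.1)))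
    * (conj (a ((σ.2.1, ω), η.2 + ξ)) * a ((σ.2.2, ω), η.2))

lemma enorm_fourWave (a : (ℝ≥0 × Ω) × ℝ → ℂ) (ξ : ℝ) (ω : Ω)
    (σ : (ℝ≥0 × ℝ≥0) × (ℝ≥0 × ℝ≥0)) (η : ℝ × ℝ) :
    ‖fourWave a ξ ω σ η‖ₑ = (‖a ((σ.1.1, ω), η.1 + ξ)‖ₑ * ‖a ((σ.1.2, ω), η.1)‖ₑ)
      * (‖a ((σ.2.1, ω), η.2 + ξ)‖ₑ * ‖a ((σ.2.2, ω), η.2)‖ₑ) := by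
  simp only [fourWave, enorm_mul, RCLike.enorm_conj]

lemma measurable_fourWave {a : (ℝ≥0 × Ω) × ℝ → ℂ} (ha : Measurable a) :
    Measurable fun p : ℝ × Ω × ((ℝ≥0 × ℝ≥0) × (ℝ≥0 × ℝ≥0)) × (ℝ × ℝ) =>
      fourWave a p.1 p.2.1 p.2.2.1 p.2.2.2 := by
  have hc : Measurable fun z : ℂ => conj z := Complex.continuous_conj.measurable
  unfold fourWave
  fun_prop

/-- The size at time `σ` of the amplitude `a`. -/
noncomputable def amplitudeNorm (a : (ℝ≥0 × Ω) × ℝ → ℂ) (ω : Ω) (σ : ℝ≥0) : ℝ≥0∞ :=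
  l2Norm fun η => ‖a ((σ, ω), η)‖ₑ

lemma measurable_amplitudeNorm {a : (ℝ≥0 × Ω) × ℝ → ℂ} (ha : Measurable a) :
    Measurable fun p : Ω × ℝ≥0 => amplitudeNorm a p.1 p.2 := by
  unfold amplitudeNorm l2Norm
  refine Measurable.pow_const ?_ _
  exact Measurable.lintegral_prod_right'
    (f := fun q : (Ω × ℝ≥0) × ℝ => ‖a ((q.1.2, q.1.1), q.2)‖ₑ ^ 2) (by fun_prop)

/-- The product of the sizes of four waves. -/
noncomputable def fourNorm (a : (ℝ≥0 × Ω) × ℝ → ℂ) (ω : Ω)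
    (σ : (ℝ≥0 × ℝ≥0) × (ℝ≥0 × ℝ≥0)) : ℝ≥0∞ :=
  (amplitudeNorm a ω σ.1.1 * amplitudeNorm a ω σ.1.2)
    * (amplitudeNorm a ω σ.2.1 * amplitudeNorm a ω σ.2.2)

lemma measurable_fourNorm {a : (ℝ≥0 × Ω) × ℝ → ℂ} (ha : Measurable a) :
    Measurable fun p : Ω × ((ℝ≥0 × ℝ≥0) × (ℝ≥0 × ℝ≥0)) => fourNorm a p.1 p.2 := by
  have h := measurable_amplitudeNorm ha
  unfold fourNorm
  have h1 : ∀ g : ((ℝ≥0 × ℝ≥0) × (ℝ≥0 × ℝ≥0)) → ℝ≥0, Measurable g →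
      Measurable fun p : Ω × ((ℝ≥0 × ℝ≥0) × (ℝ≥0 × ℝ≥0)) => amplitudeNorm a p.1 (g p.2) :=
    fun g hg => h.comp (f := fun p : Ω × ((ℝ≥0 × ℝ≥0) × (ℝ≥0 × ℝ≥0)) => (p.1, g p.2))
      (by fun_prop)
  exact ((h1 (fun σ => σ.1.1) (by fun_prop)).mul (h1 (fun σ => σ.1.2) (by fun_prop))).mul
    ((h1 (fun σ => σ.2.1) (by fun_prop)).mul (h1 (fun σ => σ.2.2) (by fun_prop)))

lemma lintegral_fourNorm {a : (ℝ≥0 × Ω) × ℝ → ℂ} (ha : Measurable a) (ω : Ω) (s t : ℝ≥0) :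
    ∫⁻ σ in timeBox s t, fourNorm a ω σ ∂timeVolume4
      = (∫⁻ σ in Set.Ioc s t, amplitudeNorm a ω σ ∂timeVolume) ^ 4 := by
  have h : Measurable (amplitudeNorm a ω) :=
    (measurable_amplitudeNorm ha).comp (f := fun σ : ℝ≥0 => (ω, σ)) (by fun_prop)
  unfold fourNorm
  rw [timeVolume4_restrict, lintegral_prod_mul
    (f := fun p : ℝ≥0 × ℝ≥0 => amplitudeNorm a ω p.1 * amplitudeNorm a ω p.2)
    (g := fun p : ℝ≥0 × ℝ≥0 => amplitudeNorm a ω p.1 * amplitudeNorm a ω p.2)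
    (by fun_prop) (by fun_prop), lintegral_prod_mul h.aemeasurable h.aemeasurable]
  ring

lemma lintegral_enorm_fourWave_le {a : (ℝ≥0 × Ω) × ℝ → ℂ} (ha : Measurable a) (ξ : ℝ) (ω : Ω)
    (σ : (ℝ≥0 × ℝ≥0) × (ℝ≥0 × ℝ≥0)) : ∫⁻ η, ‖fourWave a ξ ω σ η‖ₑ ≤ fourNorm a ω σ := by
  simp_rw [enorm_fourWave]
  exact lintegral_quadrilinear_le ξ (f₁ := fun η => ‖a ((σ.1.1, ω), η)‖ₑ)
    (f₂ := fun η => ‖a ((σ.1.2, ω), η)‖ₑ) (f₃ := fun η => ‖a ((σ.2.1, ω), η)‖ₑ)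
    (f₄ := fun η => ‖a ((σ.2.2, ω), η)‖ₑ) (by fun_prop) (by fun_prop) (by fun_prop) (by fun_prop)

lemma schrodingerSymbol_resonance (b ξ : ℝ) (η : ℝ × ℝ) :
    (schrodingerSymbol b (η.1 + ξ) * conj (schrodingerSymbol b η.1))
      * (conj (schrodingerSymbol b (η.2 + ξ)) * schrodingerSymbol b η.2)
    = Complex.exp (-(Complex.I * ((8 * Real.pi ^ 2 * ξ * (η.1 - η.2) * b : ℝ) : ℂ))) := by
  have hc : ∀ x, conj (schrodingerSymbol b x)
      = Complex.exp (Complex.I * ((b * (2 * Real.pi * x) ^ 2 : ℝ) : ℂ)) := fun x => by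
    rw [schrodingerSymbol, ← Complex.exp_conj, map_neg, map_mul, Complex.conj_I,
      Complex.conj_ofReal]
    congr 1
    ring
  rw [hc, hc, schrodingerSymbol, schrodingerSymbol, ← Complex.exp_add, ← Complex.exp_add,
    ← Complex.exp_add]
  congr 1
  push_cast
  ring

/-- The Fourier transform at time `t` of the Duhamel term, where `a` is the Fourier transform of
the forcing term, transported back to time zero by the propagator. -/
noncomputable def duhamelFourier (a : (ℝ≥0 × Ω) × ℝ → ℂ) (b : ℝ≥0 → Ω → ℝ) (s t : ℝ≥0) (ω : Ω)
    (η : ℝ) : ℂ :=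
  schrodingerSymbol (b t ω) η * ∫ σ in Set.Ioc s t, a ((σ, ω), η) ∂timeVolume

/-- The autocorrelation of `duhamelFourier`, that is, the Fourier transform of the squared modulus
of the Duhamel term. -/
noncomputable def duhamelDensity (a : (ℝ≥0 × Ω) × ℝ → ℂ) (b : ℝ≥0 → Ω → ℝ) (s t : ℝ≥0) (ω : Ω)
    (ξ : ℝ) : ℂ :=
  ∫ η, duhamelFourier a b s t ω (η + ξ) * conj (duhamelFourier a b s t ω η)

lemma duhamelDensity_mul_conj (a : (ℝ≥0 × Ω) × ℝ → ℂ) (b : ℝ≥0 → Ω → ℝ) (s t : ℝ≥0) (ω : Ω)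
    (ξ : ℝ) : duhamelDensity a b s t ω ξ * conj (duhamelDensity a b s t ω ξ)
      = ∫ η : ℝ × ℝ, ∫ σ in timeBox s t,
        Complex.exp (-(Complex.I * ((8 * Real.pi ^ 2 * ξ * (η.1 - η.2) * b t ω : ℝ) : ℂ)))
          * fourWave a ξ ω σ η ∂timeVolume4 := by
  rw [duhamelDensity, ← integral_conj, ← integral_prod_mul, ← Measure.volume_eq_prod]
  refine integral_congr_ae (Eventually.of_forall fun η => ?_)
  simp only
  rw [integral_const_mul, timeVolume4_restrict]
  unfold fourWave
  rw [integral_prod_mul (fun p : ℝ≥0 × ℝ≥0 => a ((p.1, ω), η.1 + ξ) * conj (a ((p.2, ω), η.1)))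
    (fun p : ℝ≥0 × ℝ≥0 => conj (a ((p.1, ω), η.2 + ξ)) * a ((p.2, ω), η.2)),
    integral_prod_mul (fun σ => a ((σ, ω), η.1 + ξ)) (fun σ => conj (a ((σ, ω), η.1))),
    integral_prod_mul (fun σ => conj (a ((σ, ω), η.2 + ξ))) (fun σ => a ((σ, ω), η.2)),
    integral_conj, integral_conj, ← schrodingerSymbol_resonance]
  simp only [duhamelFourier, map_mul, Complex.conj_conj]
  ring

end StochasticSmoothing

/-! ### Local smoothing on average -/

section LocalSmoothing

open Filter ComplexConjugate

variable {Ω : Type*} {mΩ : MeasurableSpace Ω} {P : Measure Ω} {𝔽 : Filtration ℝ≥0 mΩ}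
  {β : ℝ≥0 → Ω → ℝ}

/-- The second moment of the density: only the average of the oscillation of the Brownian path
after the latest of the four times matters, by independence. -/
lemma lintegral_duhamelDensity_sq_le [IsProbabilityMeasure P] (hβ : IsFilteredBrownian P 𝔽 β)
    {a : (ℝ≥0 × Ω) × ℝ → ℂ} (ha : Measurable a)
    (had : ∀ σ η, Measurable[𝔽 σ] fun ω => a ((σ, ω), η)) {s t : ℝ≥0}
    (hfin : ∫⁻ ω, (∫⁻ σ in Set.Ioc s t, amplitudeNorm a ω σ ∂timeVolume) ^ 4 ∂P < ∞) (ξ : ℝ) :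
    ∫⁻ ω, ‖duhamelDensity a β s t ω ξ‖ₑ ^ 2 ∂P
      ≤ ∫⁻ ω, ∫⁻ σ in timeBox s t, (∫⁻ η : ℝ × ℝ,
        resonanceKernel ((t : ℝ) - latest σ) ξ (η.1 - η.2) * ‖fourWave a ξ ω σ η‖ₑ)
          ∂timeVolume4 ∂P := by
  set ν := timeVolume4.restrict (timeBox s t) with hν
  set k : Ω → ((ℝ≥0 × ℝ≥0) × (ℝ≥0 × ℝ≥0)) × (ℝ × ℝ) → ℂ := fun ω z =>
    Complex.exp (-(Complex.I * ((8 * Real.pi ^ 2 * ξ * (z.2.1 - z.2.2) * β t ω : ℝ) : ℂ)))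
      * fourWave a ξ ω z.1 z.2 with hk
  have hβt : Measurable (β t) := (hβ.adapted t).measurable.mono (𝔽.le t) le_rfl
  have hfw : Measurable fun p : Ω × ((ℝ≥0 × ℝ≥0) × (ℝ≥0 × ℝ≥0)) × (ℝ × ℝ) =>
      fourWave a ξ p.1 p.2.1 p.2.2 :=
    (measurable_fourWave ha).comp
      (f := fun p : Ω × ((ℝ≥0 × ℝ≥0) × (ℝ≥0 × ℝ≥0)) × (ℝ × ℝ) => (ξ, p)) (by fun_prop)
  have hkm : Measurable (Function.uncurry k) := by
    have h1 : Measurable fun p : Ω × ((ℝ≥0 × ℝ≥0) × (ℝ≥0 × ℝ≥0)) × (ℝ × ℝ) =>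
        (8 * Real.pi ^ 2 * ξ * (p.2.2.1 - p.2.2.2) * β t p.1 : ℝ) := by fun_prop
    exact (Complex.measurable_exp.comp
      ((Complex.measurable_ofReal.comp h1).const_mul Complex.I).neg).mul hfw
  have hknorm : ∀ ω z, ‖k ω z‖ₑ = ‖fourWave a ξ ω z.1 z.2‖ₑ := by
    intro ω z
    rw [hk]
    simp only
    rw [enorm_mul, ← ofReal_norm (Complex.exp _), ← mul_neg, ← Complex.ofReal_neg,
      mul_comm Complex.I, Complex.norm_exp_ofReal_mul_I, ENNReal.ofReal_one, one_mul]
  have hkint : Integrable (Function.uncurry k) (P.prod (ν.prod volume)) := by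
    refine ⟨hkm.aestronglyMeasurable, ?_⟩
    rw [HasFiniteIntegral, lintegral_prod _ hkm.enorm.aemeasurable]
    refine lt_of_le_of_lt (lintegral_mono fun ω => ?_) hfin
    rw [← lintegral_fourNorm ha, lintegral_prod _ (by
      exact (hkm.enorm.comp (f := fun z => (ω, z)) measurable_prodMk_left).aemeasurable)]
    refine lintegral_mono fun σ => ?_
    simp only [Function.uncurry_apply_pair, hknorm]
    exact lintegral_enorm_fourWave_le ha ξ ω σ
  have hae : ∀ᵐ ω ∂P, ∫ z, k ω z ∂(ν.prod volume)
      = duhamelDensity a β s t ω ξ * conj (duhamelDensity a β s t ω ξ) := by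
    filter_upwards [hkint.prod_right_ae] with ω hω
    rw [duhamelDensity_mul_conj]
    exact integral_prod_symm _ hω
  set R : Ω → ℂ := fun ω => ∫ z, k ω z ∂(ν.prod volume) with hR
  have hRint : Integrable R P := hkint.integral_prod_left
  have h1 : ∫⁻ ω, ‖duhamelDensity a β s t ω ξ‖ₑ ^ 2 ∂P = ∫⁻ ω, ‖R ω‖ₑ ∂P := by
    refine lintegral_congr_ae ?_
    filter_upwards [hae] with ω hω
    rw [hR]
    simp only
    rw [hω, enorm_mul, RCLike.enorm_conj, sq]
  have h2 : ∫⁻ ω, ‖R ω‖ₑ ∂P = ‖∫ ω, R ω ∂P‖ₑ := by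
    have h3 : ∫ ω, R ω ∂P = ((∫ ω, ‖R ω‖ ∂P : ℝ) : ℂ) := by
      rw [← integral_complex_ofReal]
      refine integral_congr_ae ?_
      filter_upwards [hae] with ω hω
      rw [hR]
      simp only
      rw [hω, Complex.mul_conj, Complex.norm_real, Real.norm_of_nonneg (Complex.normSq_nonneg _)]
    rw [h3, ← ofReal_integral_norm_eq_lintegral_enorm hRint, ← ofReal_norm, Complex.norm_real,
      Real.norm_of_nonneg (integral_nonneg fun _ => norm_nonneg _)]
  have h4 : ∫ ω, R ω ∂P = ∫ z, ∫ ω, k ω z ∂P ∂(ν.prod volume) := integral_integral_swap hkint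
  have hbox : ∀ᵐ z ∂(ν.prod (volume : Measure (ℝ × ℝ))), z.1 ∈ timeBox s t :=
    Measure.quasiMeasurePreserving_fst.ae (ae_restrict_mem (measurableSet_timeBox s t))
  have hKm : Measurable fun p : (((ℝ≥0 × ℝ≥0) × (ℝ≥0 × ℝ≥0)) × (ℝ × ℝ)) × Ω =>
      resonanceKernel ((t : ℝ) - latest p.1.1) ξ (p.1.2.1 - p.1.2.2)
        * ‖fourWave a ξ p.2 p.1.1 p.1.2‖ₑ := by
    have := hfw.comp (f := fun p : (((ℝ≥0 × ℝ≥0) × (ℝ≥0 × ℝ≥0)) × (ℝ × ℝ)) × Ω => (p.2, p.1))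
      (by fun_prop)
    refine Measurable.mul ?_ this.enorm
    fun_prop
  rw [h1, h2, h4]
  calc ‖∫ z, ∫ ω, k ω z ∂P ∂(ν.prod volume)‖ₑ
      ≤ ∫⁻ z, ‖∫ ω, k ω z ∂P‖ₑ ∂(ν.prod volume) := enorm_integral_le_lintegral_enorm _
    _ ≤ ∫⁻ z, ∫⁻ ω, resonanceKernel ((t : ℝ) - latest z.1) ξ (z.2.1 - z.2.2)
          * ‖fourWave a ξ ω z.1 z.2‖ₑ ∂P ∂(ν.prod volume) := by
        refine lintegral_mono_ae (hbox.mono fun z hz => ?_)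
        have hm := latest_le_of_mem_timeBox hz
        have hc : Measurable fun z : ℂ => conj z := Complex.continuous_conj.measurable
        have hG : Measurable[𝔽 (latest z.1)] fun ω => fourWave a ξ ω z.1 z.2 := by
          have h5 : ∀ σ ≤ latest z.1, ∀ η, Measurable[𝔽 (latest z.1)] fun ω => a ((σ, ω), η) :=
            fun σ hσ η => (had σ η).mono (𝔽.mono hσ) le_rfl
          unfold fourWave
          exact ((h5 _ ((le_max_left _ _).trans (le_max_left _ _)) _).mul
            (hc.comp (h5 _ ((le_max_right _ _).trans (le_max_left _ _)) _))).mul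
            ((hc.comp (h5 _ ((le_max_left _ _).trans (le_max_right _ _)) _)).mul
            (h5 _ ((le_max_right _ _).trans (le_max_right _ _)) _))
        refine (enorm_integral_exp_brownian_mul_le hβ hm
          (8 * Real.pi ^ 2 * ξ * (z.2.1 - z.2.2)) hG).trans_eq ?_
        exact (lintegral_const_mul' _ _ ENNReal.ofReal_ne_top).symm
    _ = ∫⁻ ω, ∫⁻ z, resonanceKernel ((t : ℝ) - latest z.1) ξ (z.2.1 - z.2.2)
          * ‖fourWave a ξ ω z.1 z.2‖ₑ ∂(ν.prod volume) ∂P :=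
        lintegral_lintegral_swap hKm.aemeasurable
    _ = _ := by
        refine lintegral_congr fun ω => ?_
        rw [lintegral_prod _ (by
          exact (hKm.comp (f := fun z => (z, ω)) measurable_prodMk_right).aemeasurable)]

lemma lintegral_rotate {X Y Z : Type*} [MeasurableSpace X] [MeasurableSpace Y] [MeasurableSpace Z]
    {μ : Measure X} {ν : Measure Y} {ρ : Measure Z} [SFinite μ] [SFinite ν] [SFinite ρ]
    {g : X × Y × Z → ℝ≥0∞} (hg : Measurable g) :
    ∫⁻ x, ∫⁻ y, ∫⁻ z, g (x, y, z) ∂ρ ∂ν ∂μ = ∫⁻ y, ∫⁻ z, ∫⁻ x, g (x, y, z) ∂μ ∂ρ ∂ν := by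
  have h1 : Measurable fun p : X × Y => ∫⁻ z, g (p.1, p.2, z) ∂ρ :=
    Measurable.lintegral_prod_right' (f := fun q : (X × Y) × Z => g (q.1.1, q.1.2, q.2))
      (by fun_prop)
  rw [lintegral_lintegral_swap h1.aemeasurable]
  refine lintegral_congr fun y => ?_
  exact lintegral_lintegral_swap (f := fun x z => g (x, y, z))
    (Measurable.aemeasurable (f := fun p : X × Z => g (p.1, y, p.2)) (by fun_prop))

/-- Local smoothing on average: the density of the Duhamel term gains half a derivative, and the
factor `T^(1/2)` is the integral of the singularity `(t - m)^(-1/2)`. -/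
lemma lintegral_localSmoothing_le [IsProbabilityMeasure P] (hβ : IsFilteredBrownian P 𝔽 β)
    {a : (ℝ≥0 × Ω) × ℝ → ℂ} (ha : Measurable a)
    (had : ∀ σ η, Measurable[𝔽 σ] fun ω => a ((σ, ω), η)) {s T : ℝ≥0}
    (hfin : ∫⁻ ω, (∫⁻ σ in Set.Ioc s (s + T), amplitudeNorm a ω σ ∂timeVolume) ^ 4 ∂P < ∞) :
    ∫⁻ t in Set.Ioc s (s + T),
        (∫⁻ ξ, ‖ξ‖ₑ * (∫⁻ ω, ‖duhamelDensity a β s t ω ξ‖ₑ ^ 2 ∂P)) ∂timeVolume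
      ≤ 2 * ENNReal.ofReal T ^ (1 / 2 : ℝ)
        * ∫⁻ ω, (∫⁻ σ in Set.Ioc s (s + T), amplitudeNorm a ω σ ∂timeVolume) ^ 4 ∂P := by
  set S : ℝ≥0 → ((ℝ≥0 × ℝ≥0) × (ℝ≥0 × ℝ≥0)) → ℝ≥0∞ := fun t σ =>
    if latest σ ≤ t then ENNReal.ofReal ((t : ℝ) - latest σ) ^ (-(1 / 2) : ℝ) else 0 with hS
  have hN := measurable_fourNorm (Ω := Ω) ha
  have hSm : Measurable fun p : ℝ≥0 × ((ℝ≥0 × ℝ≥0) × (ℝ≥0 × ℝ≥0)) => S p.1 p.2 :=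
    Measurable.ite (measurableSet_le (by fun_prop) (by fun_prop)) (by fun_prop) measurable_const
  have hstep : ∀ t ∈ Set.Ioc s (s + T),
      ∫⁻ ξ, ‖ξ‖ₑ * (∫⁻ ω, ‖duhamelDensity a β s t ω ξ‖ₑ ^ 2 ∂P)
      ≤ ∫⁻ ω, ∫⁻ σ in timeBox s (s + T), S t σ * fourNorm a ω σ ∂timeVolume4 ∂P := by
    intro t ht
    have hfin' : ∫⁻ ω, (∫⁻ σ in Set.Ioc s t, amplitudeNorm a ω σ ∂timeVolume) ^ 4 ∂P < ∞ := by
      refine lt_of_le_of_lt (lintegral_mono fun ω => ?_) hfin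
      gcongr
      exact ht.2
    set g : ℝ × Ω × ((ℝ≥0 × ℝ≥0) × (ℝ≥0 × ℝ≥0)) → ℝ≥0∞ := fun p => ∫⁻ η : ℝ × ℝ,
      ‖p.1‖ₑ * resonanceKernel ((t : ℝ) - latest p.2.2) p.1 (η.1 - η.2)
        * ‖fourWave a p.1 p.2.1 p.2.2 η‖ₑ with hg
    have hgm : Measurable g := by
      refine Measurable.lintegral_prod_right' (f := fun q : (ℝ × Ω × ((ℝ≥0 × ℝ≥0) × (ℝ≥0 × ℝ≥0)))
        × (ℝ × ℝ) => ‖q.1.1‖ₑ * resonanceKernel ((t : ℝ) - latest q.1.2.2) q.1.1 (q.2.1 - q.2.2)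
        * ‖fourWave a q.1.1 q.1.2.1 q.1.2.2 q.2‖ₑ) ?_
      have h1 := (measurable_fourWave ha).comp
        (f := fun q : (ℝ × Ω × ((ℝ≥0 × ℝ≥0) × (ℝ≥0 × ℝ≥0))) × (ℝ × ℝ) =>
          (q.1.1, q.1.2.1, q.1.2.2, q.2)) (by fun_prop)
      refine Measurable.mul ?_ h1.enorm
      fun_prop
    calc ∫⁻ ξ, ‖ξ‖ₑ * (∫⁻ ω, ‖duhamelDensity a β s t ω ξ‖ₑ ^ 2 ∂P)
        ≤ ∫⁻ ξ, ‖ξ‖ₑ * (∫⁻ ω, ∫⁻ σ in timeBox s t, (∫⁻ η : ℝ × ℝ,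
          resonanceKernel ((t : ℝ) - latest σ) ξ (η.1 - η.2) * ‖fourWave a ξ ω σ η‖ₑ)
          ∂timeVolume4 ∂P) := by
          exact lintegral_mono fun ξ =>
            mul_le_mul' le_rfl (lintegral_duhamelDensity_sq_le hβ ha had hfin' ξ)
      _ = ∫⁻ ξ, (∫⁻ ω, ∫⁻ σ in timeBox s t, g (ξ, ω, σ) ∂timeVolume4 ∂P) := by
          refine lintegral_congr fun ξ => ?_
          rw [← lintegral_const_mul' _ _ enorm_ne_top]
          refine lintegral_congr fun ω => ?_
          rw [← lintegral_const_mul' _ _ enorm_ne_top]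
          refine lintegral_congr fun σ => ?_
          rw [← lintegral_const_mul' _ _ enorm_ne_top]
          simp only [hg, mul_assoc]
      _ = ∫⁻ ω, ∫⁻ σ in timeBox s t, (∫⁻ ξ, g (ξ, ω, σ)) ∂timeVolume4 ∂P := lintegral_rotate hgm
      _ ≤ ∫⁻ ω, ∫⁻ σ in timeBox s t, S t σ * fourNorm a ω σ ∂timeVolume4 ∂P := by
          refine lintegral_mono fun ω => setLIntegral_mono' (measurableSet_timeBox s t)
            fun σ hσ => ?_
          rw [hS]
          simp only
          rw [if_pos (latest_le_of_mem_timeBox hσ), hg]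
          simp only [enorm_fourWave]
          exact lintegral_resonance_quadrilinear_le ((t : ℝ) - latest σ)
            (f₁ := fun η => ‖a ((σ.1.1, ω), η)‖ₑ)
            (f₂ := fun η => ‖a ((σ.1.2, ω), η)‖ₑ) (f₃ := fun η => ‖a ((σ.2.1, ω), η)‖ₑ)
            (f₄ := fun η => ‖a ((σ.2.2, ω), η)‖ₑ) (by fun_prop) (by fun_prop) (by fun_prop)
            (by fun_prop)
      _ ≤ _ := by
          refine lintegral_mono fun ω => lintegral_mono_set fun σ hσ => ?_
          rw [mem_timeBox_iff] at hσ ⊢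
          exact ⟨⟨⟨hσ.1.1.1, hσ.1.1.2.trans ht.2⟩, ⟨hσ.1.2.1, hσ.1.2.2.trans ht.2⟩⟩,
            ⟨⟨hσ.2.1.1, hσ.2.1.2.trans ht.2⟩, ⟨hσ.2.2.1, hσ.2.2.2.trans ht.2⟩⟩⟩
  calc _ ≤ ∫⁻ t in Set.Ioc s (s + T), ∫⁻ ω, ∫⁻ σ in timeBox s (s + T),
          S t σ * fourNorm a ω σ ∂timeVolume4 ∂P ∂timeVolume :=
        setLIntegral_mono' measurableSet_Ioc hstep
    _ = ∫⁻ ω, ∫⁻ σ in timeBox s (s + T), ∫⁻ t in Set.Ioc s (s + T),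
          S t σ * fourNorm a ω σ ∂timeVolume ∂timeVolume4 ∂P := by
        refine lintegral_rotate (g := fun p : ℝ≥0 × Ω × ((ℝ≥0 × ℝ≥0) × (ℝ≥0 × ℝ≥0)) =>
          S p.1 p.2.2 * fourNorm a p.2.1 p.2.2) ?_
        exact (hSm.comp (f := fun p : ℝ≥0 × Ω × ((ℝ≥0 × ℝ≥0) × (ℝ≥0 × ℝ≥0)) => (p.1, p.2.2))
          (by fun_prop)).mul (hN.comp
          (f := fun p : ℝ≥0 × Ω × ((ℝ≥0 × ℝ≥0) × (ℝ≥0 × ℝ≥0)) => p.2) measurable_snd)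
    _ ≤ ∫⁻ ω, ∫⁻ σ in timeBox s (s + T), 2 * ENNReal.ofReal T ^ (1 / 2 : ℝ) * fourNorm a ω σ
          ∂timeVolume4 ∂P := by
        refine lintegral_mono fun ω => setLIntegral_mono' (measurableSet_timeBox s _)
          fun σ hσ => ?_
        have hSσ : Measurable fun t => S t σ :=
          hSm.comp (f := fun t : ℝ≥0 => (t, σ)) (by fun_prop)
        rw [lintegral_mul_const _ hSσ]
        gcongr
        exact lintegral_inv_sqrt_le s T _ (le_latest_of_mem_timeBox hσ)
    _ = _ := by
        rw [← lintegral_const_mul' _ _ (by finiteness)]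
        refine lintegral_congr fun ω => ?_
        rw [← lintegral_fourNorm ha, ← lintegral_const_mul' _ _ (by finiteness)]

end LocalSmoothing

/-! ### The Duhamel term -/

section DuhamelTerm

open Filter ComplexConjugate

variable {Ω : Type*} {mΩ : MeasurableSpace Ω} {P : Measure Ω} {𝔽 : Filtration ℝ≥0 mΩ}
  {β b : ℝ≥0 → Ω → ℝ} {f g : ℝ≥0 → Ω → L2R} {s t T : ℝ≥0} {ω : Ω}

lemma isStronglyPredictable_schrodingerGroup (hb : IsStronglyPredictable 𝔽 b)
    (hg : IsStronglyPredictable 𝔽 g) :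
    IsStronglyPredictable 𝔽 fun t ω => schrodingerGroup (b t ω) (g t ω) := by
  have h : StronglyMeasurable[𝔽.predictable] fun p : ℝ≥0 × Ω =>
      (Function.uncurry b p, Function.uncurry g p) := @StronglyMeasurable.prodMk _ _ _ 𝔽.predictable
        _ _ _ _ hb hg
  exact (continuous_schrodingerGroup.comp_stronglyMeasurable h :)

/-- The process `g`, transported at each time back to time zero by the Schrödinger group. -/
noncomputable def pullBack (b : ℝ≥0 → Ω → ℝ) (g : ℝ≥0 → Ω → L2R) (σ : ℝ≥0) (ω : Ω) : L2R :=
  schrodingerGroup (-(b σ ω)) (g σ ω)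

lemma isStronglyPredictable_pullBack (hb : IsStronglyPredictable 𝔽 b)
    (hg : IsStronglyPredictable 𝔽 g) : IsStronglyPredictable 𝔽 (pullBack b g) :=
  isStronglyPredictable_schrodingerGroup (b := fun σ ω => -(b σ ω))
    (continuous_neg.comp_stronglyMeasurable hb) hg

lemma enorm_pullBack (σ : ℝ≥0) (ω : Ω) : ‖pullBack b g σ ω‖ₑ = ‖g σ ω‖ₑ := by
  rw [← ofReal_norm, ← ofReal_norm, pullBack, norm_schrodingerGroup]

/-- The Fourier transform of `pullBack b g`, as a jointly measurable function. -/
noncomputable def amplitude (b : ℝ≥0 → Ω → ℝ) (g : ℝ≥0 → Ω → L2R) (p : (ℝ≥0 × Ω) × ℝ) : ℂ :=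
  lebesgueRep (𝓕 (pullBack b g p.1.1 p.1.2) : L2R) p.2

lemma measurable_fourier_L2 : Measurable fun u : L2R => (𝓕 u : L2R) :=
  (Lp.fourierTransformₗᵢ ℝ ℂ).continuous.measurable

lemma measurable_amplitude (hb : IsStronglyPredictable 𝔽 b) (hg : IsStronglyPredictable 𝔽 g) :
    Measurable (amplitude b g) := by
  have h := (stronglyMeasurable_uncurry_of_isStronglyPredictable
    (isStronglyPredictable_pullBack hb hg)).measurable
  exact ((measurable_fourier_L2.comp h).comp measurable_fst).lebesgueRep measurable_snd

lemma measurable_amplitude_apply (hb : IsStronglyPredictable 𝔽 b)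
    (hg : IsStronglyPredictable 𝔽 g) (σ : ℝ≥0) (η : ℝ) :
    Measurable[𝔽 σ] fun ω => amplitude b g ((σ, ω), η) := by
  have h := ((isStronglyPredictable_pullBack hb hg).stronglyAdapted σ).measurable
  exact @Measurable.lebesgueRep Ω (𝔽 σ) _ _ (measurable_fourier_L2.comp h) measurable_const

lemma amplitudeNorm_amplitude (ω : Ω) (σ : ℝ≥0) :
    amplitudeNorm (amplitude b g) ω σ = ‖g σ ω‖ₑ := by
  have h : ∫⁻ η, ‖amplitude b g ((σ, ω), η)‖ₑ ^ 2 = ‖g σ ω‖ₑ ^ 2 := by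
    rw [← enorm_pullBack (b := b), ← ofReal_norm, ← Lp.norm_fourier_eq, ofReal_norm,
      ← lintegral_enorm_sq_L2]
    refine lintegral_congr_ae ?_
    filter_upwards [lebesgueRep_ae_eq (𝓕 (pullBack b g σ ω) : L2R)] with η hη
    rw [amplitude, hη]
  rw [amplitudeNorm, l2Norm, h, ← ENNReal.rpow_natCast, ← ENNReal.rpow_mul]
  norm_num

/-- The Duhamel term, with the forcing term replaced by `g` and the Brownian motion by `b`. It is
defined as the propagation of a left limit, so as to be predictable. -/
noncomputable def duhamelVersion (b : ℝ≥0 → Ω → ℝ) (g : ℝ≥0 → Ω → L2R) (s t : ℝ≥0) (ω : Ω) : L2R :=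
  schrodingerGroup (b t ω)
    (leftLimitProcess (fun t ω => ∫ σ in Set.Ioc s t, pullBack b g σ ω ∂timeVolume) t ω)

lemma isStronglyPredictable_duhamelVersion (hb : IsStronglyPredictable 𝔽 b)
    (hg : IsStronglyPredictable 𝔽 g) (s : ℝ≥0) : IsStronglyPredictable 𝔽 (duhamelVersion b g s) :=
  isStronglyPredictable_schrodingerGroup hb (isStronglyPredictable_leftLimitProcess
    (stronglyAdapted_setIntegral (isStronglyPredictable_pullBack hb hg) s))

lemma noisePropagator_eq (hb : ∀ t, b t ω = β t ω) (t σ : ℝ≥0) :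
    noisePropagator β t σ ω (g σ ω) = schrodingerGroup (b t ω) (pullBack b g σ ω) := by
  rw [noisePropagator, pullBack, schrodingerGroup_schrodingerGroup, hb, hb, sub_eq_add_neg]

lemma noisePropagator_ae_eq (hb : ∀ t, b t ω = β t ω)
    (hfg : ∀ᵐ σ ∂timeVolume.restrict (Set.Ioc s t), f σ ω = g σ ω) :
    (fun σ => noisePropagator β t σ ω (f σ ω)) =ᵐ[timeVolume.restrict (Set.Ioc s t)]
      fun σ => schrodingerGroup (b t ω) (pullBack b g σ ω) := by
  filter_upwards [hfg] with σ hσ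
  rw [hσ, noisePropagator_eq hb]

lemma duhamel_eq_duhamelVersion (hb : ∀ t, b t ω = β t ω)
    (hfg : ∀ᵐ σ ∂timeVolume.restrict (Set.Ioc s t), f σ ω = g σ ω)
    (hi : IntegrableOn (fun σ => pullBack b g σ ω) (Set.Ioc s t) timeVolume) :
    duhamel β f s t ω = duhamelVersion b g s t ω := by
  rw [duhamel, duhamelVersion, leftLimitProcess_setIntegral hi,
    integral_congr_ae (noisePropagator_ae_eq hb hfg), integral_schrodingerGroup _ hi]

lemma integrableOn_pullBack (hb : IsStronglyPredictable 𝔽 b) (hg : IsStronglyPredictable 𝔽 g)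
    (hfin : ∫⁻ σ in Set.Ioc s t, ‖g σ ω‖ₑ ∂timeVolume < ∞) :
    IntegrableOn (fun σ => pullBack b g σ ω) (Set.Ioc s t) timeVolume := by
  refine ⟨?_, ?_⟩
  · exact ((stronglyMeasurable_uncurry_of_isStronglyPredictable
      (isStronglyPredictable_pullBack hb hg)).comp_measurable
      measurable_prodMk_right).aestronglyMeasurable
  · simpa only [HasFiniteIntegral, enorm_pullBack] using hfin

lemma coeFn_fourier_duhamelVersion (hb : IsStronglyPredictable 𝔽 b)
    (hg : IsStronglyPredictable 𝔽 g)
    (hi : IntegrableOn (fun σ => pullBack b g σ ω) (Set.Ioc s t) timeVolume) :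
    (𝓕 (duhamelVersion b g s t ω) : L2R) =ᵐ[volume] duhamelFourier (amplitude b g) b s t ω := by
  have hm : Measurable fun σ => pullBack b g σ ω :=
    ((stronglyMeasurable_uncurry_of_isStronglyPredictable
      (isStronglyPredictable_pullBack hb hg)).measurable.comp measurable_prodMk_right :)
  set L : L2R →L[ℂ] L2R := (Lp.fourierTransformₗᵢ ℝ ℂ).toLinearIsometry.toContinuousLinearMap
  have hcomm : L (∫ σ in Set.Ioc s t, pullBack b g σ ω ∂timeVolume)
      = ∫ σ in Set.Ioc s t, L (pullBack b g σ ω) ∂timeVolume := (L.integral_comp_comm hi).symm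
  have hi' : Integrable (fun σ => L (pullBack b g σ ω))
      (timeVolume.restrict (Set.Ioc s t)) := L.integrable_comp hi
  have hrep := coeFn_integral_ae_eq (L.continuous.measurable.comp hm) hi'
  have hL : ∀ u : L2R, (𝓕 u : L2R) = L u := fun _ => rfl
  rw [duhamelVersion, leftLimitProcess_setIntegral hi]
  filter_upwards [coeFn_fourier_schrodingerGroup (b t ω)
    (∫ σ in Set.Ioc s t, pullBack b g σ ω ∂timeVolume), hrep] with ξ h1 h2
  rw [h1, hL, hcomm, duhamelFourier]
  exact congrArg _ h2

lemma enorm_duhamelVersion_le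
    (hi : IntegrableOn (fun σ => pullBack b g σ ω) (Set.Ioc s t) timeVolume) :
    ‖duhamelVersion b g s t ω‖ₑ ≤ ∫⁻ σ in Set.Ioc s t, ‖g σ ω‖ₑ ∂timeVolume := by
  rw [duhamelVersion, leftLimitProcess_setIntegral hi, ← ofReal_norm, norm_schrodingerGroup,
    ofReal_norm]
  refine (enorm_integral_le_lintegral_enorm _).trans (le_of_eq ?_)
  simp_rw [enorm_pullBack]

lemma eLpNorm_duhamelVersion_le (hb : IsStronglyPredictable 𝔽 b) (hg : IsStronglyPredictable 𝔽 g)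
    (hi : IntegrableOn (fun σ => pullBack b g σ ω) (Set.Ioc s t) timeVolume) :
    eLpNorm (duhamelVersion b g s t ω) 10 volume ^ 5
      ≤ 46080 * (∫⁻ σ in Set.Ioc s t, ‖g σ ω‖ₑ ∂timeVolume)
        * ∫⁻ ξ, ‖ξ‖ₑ * ‖duhamelDensity (amplitude b g) b s t ω ξ‖ₑ ^ 2 := by
  have hF := coeFn_fourier_duhamelVersion hb hg hi
  have hd : ∀ ξ : ℝ, ∫ η, (𝓕 (duhamelVersion b g s t ω) : L2R) (η + ξ)
      * conj ((𝓕 (duhamelVersion b g s t ω) : L2R) η)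
      = duhamelDensity (amplitude b g) b s t ω ξ := by
    intro ξ
    have hF' := (measurePreserving_add_right volume ξ).quasiMeasurePreserving.ae_eq_comp hF
    refine integral_congr_ae ?_
    filter_upwards [hF, hF'] with η h1 h2
    simp only [Function.comp_apply] at h2
    rw [h1, h2]
  refine (eLpNorm_ten_pow_five_le _).trans ?_
  simp_rw [hd]
  gcongr
  exact enorm_duhamelVersion_le hi

lemma measurable_duhamelDensity {a : (ℝ≥0 × Ω) × ℝ → ℂ} (ha : Measurable a)
    (hb : Measurable (Function.uncurry b)) (s : ℝ≥0) :
    Measurable fun p : (ℝ≥0 × Ω) × ℝ => duhamelDensity a b s p.1.1 p.1.2 p.2 := by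
  have hc : Measurable fun z : ℂ => conj z := Complex.continuous_conj.measurable
  have h1 : Measurable fun p : (ℝ≥0 × Ω) × ℝ =>
      ∫ σ in Set.Ioc s p.1.1, a ((σ, p.1.2), p.2) ∂timeVolume := by
    have h2 : StronglyMeasurable fun q : ((ℝ≥0 × Ω) × ℝ) × ℝ≥0 =>
        (Set.Ioc s q.1.1.1).indicator (fun σ => a ((σ, q.1.1.2), q.1.2)) q.2 := by
      refine Measurable.stronglyMeasurable ?_
      simp only [Set.indicator_apply, Set.mem_Ioc]
      exact Measurable.ite ((measurableSet_lt measurable_const measurable_snd).inter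
        (measurableSet_le (f := fun q : ((ℝ≥0 × Ω) × ℝ) × ℝ≥0 => q.2)
          (g := fun q => q.1.1.1) (by fun_prop) (by fun_prop))) (by fun_prop) measurable_const
    simp_rw [← integral_indicator measurableSet_Ioc]
    exact (h2.integral_prod_right (ν := timeVolume)).measurable
  have h3 : Measurable fun p : (ℝ≥0 × Ω) × ℝ => duhamelFourier a b s p.1.1 p.1.2 p.2 := by
    refine Measurable.mul ?_ h1
    exact continuous_schrodingerSymbol_uncurry.measurable.comp
      ((hb.comp measurable_fst).prodMk measurable_snd)
  refine (StronglyMeasurable.integral_prod_right (ν := (volume : Measure ℝ))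
    (f := fun (p : (ℝ≥0 × Ω) × ℝ) (η : ℝ) => duhamelFourier a b s p.1.1 p.1.2 (η + p.2)
      * conj (duhamelFourier a b s p.1.1 p.1.2 η)) (Measurable.stronglyMeasurable ?_)).measurable
  have h4 := h3.comp (f := fun q : ((ℝ≥0 × Ω) × ℝ) × ℝ => (q.1.1, q.2 + q.1.2)) (by fun_prop)
  have h5 := h3.comp (f := fun q : ((ℝ≥0 × Ω) × ℝ) × ℝ => (q.1.1, q.2)) (by fun_prop)
  exact h4.mul (hc.comp h5)

/-- The squared norm of the density of the Duhamel term in the homogeneous Sobolev space of order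
`1 / 2`. -/
noncomputable def densityEnergy (a : (ℝ≥0 × Ω) × ℝ → ℂ) (b : ℝ≥0 → Ω → ℝ) (s t : ℝ≥0) (ω : Ω) :
    ℝ≥0∞ :=
  ∫⁻ ξ, ‖ξ‖ₑ * ‖duhamelDensity a b s t ω ξ‖ₑ ^ 2

lemma measurable_densityEnergy {a : (ℝ≥0 × Ω) × ℝ → ℂ} (ha : Measurable a)
    (hb : Measurable (Function.uncurry b)) (s : ℝ≥0) :
    Measurable fun p : ℝ≥0 × Ω => densityEnergy a b s p.1 p.2 := by
  have h := measurable_duhamelDensity ha hb s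
  exact Measurable.lintegral_prod_right' (f := fun q : (ℝ≥0 × Ω) × ℝ =>
    ‖q.2‖ₑ * ‖duhamelDensity a b s q.1.1 q.1.2 q.2‖ₑ ^ 2) (by fun_prop)

end DuhamelTerm

/-! ### The space-time estimate -/

section SpaceTimeEstimate

open Filter

variable {Ω : Type*} {mΩ : MeasurableSpace Ω} {P : Measure Ω} {𝔽 : Filtration ℝ≥0 mΩ}
  {β b : ℝ≥0 → Ω → ℝ} {f g : ℝ≥0 → Ω → L2R} {s t T : ℝ≥0} {ω : Ω}

/-- `lintegral_localSmoothing_le` for a measurable version `b` of the Brownian motion. -/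
lemma lintegral_densityEnergy_le [IsProbabilityMeasure P] (hβ : IsFilteredBrownian P 𝔽 β)
    (hb : Measurable (Function.uncurry b)) (hbβ : ∀ᵐ ω ∂P, ∀ t, b t ω = β t ω)
    {a : (ℝ≥0 × Ω) × ℝ → ℂ} (ha : Measurable a)
    (had : ∀ σ η, Measurable[𝔽 σ] fun ω => a ((σ, ω), η))
    (hfin : ∫⁻ ω, (∫⁻ σ in Set.Ioc s (s + T), amplitudeNorm a ω σ ∂timeVolume) ^ 4 ∂P < ∞) :
    ∫⁻ ω, ∫⁻ t in Set.Ioc s (s + T), densityEnergy a b s t ω ∂timeVolume ∂P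
      ≤ 2 * ENNReal.ofReal T ^ (1 / 2 : ℝ)
        * ∫⁻ ω, (∫⁻ σ in Set.Ioc s (s + T), amplitudeNorm a ω σ ∂timeVolume) ^ 4 ∂P := by
  refine le_trans (le_of_eq ?_) (lintegral_localSmoothing_le hβ ha had hfin)
  have hm : Measurable fun p : Ω × ℝ≥0 => densityEnergy a b s p.2 p.1 :=
    ((measurable_densityEnergy ha hb s).comp measurable_swap :)
  rw [lintegral_lintegral_swap (f := fun ω t => densityEnergy a b s t ω) hm.aemeasurable]
  refine lintegral_congr fun t => ?_
  have hd := measurable_duhamelDensity ha hb s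
  unfold densityEnergy
  rw [lintegral_lintegral_swap (f := fun ω ξ => ‖ξ‖ₑ * ‖duhamelDensity a b s t ω ξ‖ₑ ^ 2)]
  · refine lintegral_congr fun ξ => ?_
    rw [lintegral_const_mul' _ _ enorm_ne_top]
    congr 1
    refine lintegral_congr_ae ?_
    filter_upwards [hbβ] with ω hω
    simp only [duhamelDensity, duhamelFourier, hω]
  · have h2 : Measurable fun p : Ω × ℝ => duhamelDensity a b s t p.1 p.2 :=
      (hd.comp (f := fun p : Ω × ℝ => ((t, p.1), p.2)) (by fun_prop) :)
    exact (measurable_snd.enorm.mul (h2.enorm.pow_const 2)).aemeasurable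

/-- Hölder's inequality with the exponents `5` and `5 / 4`. -/
lemma lintegral_pow_four_le {α : Type*} [MeasurableSpace α] {μ : Measure α}
    {N F Y : α → ℝ≥0∞} {C D : ℝ≥0∞} (hF : AEMeasurable F μ) (hY : AEMeasurable Y μ)
    (hN : ∀ᵐ x ∂μ, N x ^ 5 ≤ C * F x * Y x) (hC : C ≠ ∞)
    (hYF : ∫⁻ x, Y x ∂μ ≤ D * ∫⁻ x, F x ^ 4 ∂μ) :
    ∫⁻ x, N x ^ 4 ∂μ ≤ (C * D) ^ (4 / 5 : ℝ) * ∫⁻ x, F x ^ 4 ∂μ := by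
  have h45 : (0 : ℝ) ≤ 4 / 5 := by norm_num
  set E := ∫⁻ x, F x ^ 4 ∂μ
  calc ∫⁻ x, N x ^ 4 ∂μ
      ≤ ∫⁻ x, C ^ (4 / 5 : ℝ) * ((F x ^ 4) ^ (1 / 5 : ℝ) * Y x ^ (4 / 5 : ℝ)) ∂μ := by
        refine lintegral_mono_ae (hN.mono fun x hx => ?_)
        calc N x ^ 4 = (N x ^ 5) ^ (4 / 5 : ℝ) := by
              rw [← ENNReal.rpow_natCast, ← ENNReal.rpow_natCast, ← ENNReal.rpow_mul]
              norm_num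
          _ ≤ (C * F x * Y x) ^ (4 / 5 : ℝ) := by gcongr
          _ = _ := by
              rw [ENNReal.mul_rpow_of_nonneg _ _ h45, ENNReal.mul_rpow_of_nonneg _ _ h45,
                ← ENNReal.rpow_natCast (F x), ← ENNReal.rpow_mul, mul_assoc]
              norm_num
    _ = C ^ (4 / 5 : ℝ) * ∫⁻ x, (F x ^ 4) ^ (1 / 5 : ℝ) * Y x ^ (4 / 5 : ℝ) ∂μ :=
        lintegral_const_mul' _ _ (ENNReal.rpow_ne_top_of_nonneg h45 hC)
    _ ≤ C ^ (4 / 5 : ℝ) * (E ^ (1 / 5 : ℝ) * (∫⁻ x, Y x ∂μ) ^ (4 / 5 : ℝ)) := by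
        gcongr
        exact ENNReal.lintegral_mul_norm_pow_le (hF.pow_const 4) hY (by norm_num) h45 (by norm_num)
    _ ≤ C ^ (4 / 5 : ℝ) * (E ^ (1 / 5 : ℝ) * (D * E) ^ (4 / 5 : ℝ)) := by gcongr
    _ = _ := by
        rw [ENNReal.mul_rpow_of_nonneg _ _ h45, ENNReal.mul_rpow_of_nonneg _ _ h45,
          mul_left_comm (E ^ _), ← ENNReal.rpow_add_of_nonneg _ _ (by norm_num) h45, mul_assoc]
        norm_num

lemma eLpNorm_four_eq {α ε : Type*} [MeasurableSpace α] [TopologicalSpace ε] [ContinuousENorm ε]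
    {μ : Measure α} (N : α → ε) :
    eLpNorm N 4 μ = (∫⁻ x, ‖N x‖ₑ ^ 4 ∂μ) ^ (1 / 4 : ℝ) := by
  rw [eLpNorm_eq_lintegral_rpow_enorm_toReal (by norm_num) (by norm_num)]
  simp only [ENNReal.toReal_ofNat, ENNReal.rpow_ofNat]

lemma eLpNorm_five_pow_eq {α ε : Type*} [MeasurableSpace α] [TopologicalSpace ε]
    [ContinuousENorm ε] {μ : Measure α} (N : α → ε) :
    eLpNorm N 5 μ ^ 5 = ∫⁻ x, ‖N x‖ₑ ^ 5 ∂μ := by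
  rw [eLpNorm_eq_lintegral_rpow_enorm_toReal (by norm_num) (by norm_num), ← ENNReal.rpow_natCast,
    ← ENNReal.rpow_mul]
  norm_num

lemma mixedNorm_four_one_eq (g : ℝ≥0 → Ω → L2R) : mixedNorm P 4 1 s T g
    = (∫⁻ ω, (∫⁻ σ in Set.Ioc s (s + T), ‖g σ ω‖ₑ ∂timeVolume) ^ 4 ∂P) ^ (1 / 4 : ℝ) := by
  rw [mixedNorm, eLpNorm_four_eq]
  simp only [eLpNorm_one_eq_lintegral_enorm, enorm_eq_self]

lemma ae_lintegral_enorm_lt_top [IsProbabilityMeasure P] (hg : IsStronglyPredictable 𝔽 g)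
    (hfin : mixedNorm P 4 1 s T g < ∞) :
    ∀ᵐ ω ∂P, ∫⁻ σ in Set.Ioc s (s + T), ‖g σ ω‖ₑ ∂timeVolume < ∞ := by
  have h : Measurable fun p : Ω × ℝ≥0 => ‖g p.2 p.1‖ₑ :=
    ((stronglyMeasurable_uncurry_of_isStronglyPredictable hg).measurable.comp
      measurable_swap :).enorm
  have hFm : Measurable fun ω => ∫⁻ σ in Set.Ioc s (s + T), ‖g σ ω‖ₑ ∂timeVolume :=
    h.lintegral_prod_right'
  rw [mixedNorm_four_one_eq] at hfin
  filter_upwards [ae_lt_top (hFm.pow_const 4)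
    ((ENNReal.rpow_lt_top_iff_of_pos (by norm_num)).1 hfin).ne] with ω hω
  exact ENNReal.pow_lt_top_iff.1 hω |>.resolve_right (by norm_num)

/-- The space-time estimate for the predictable version of the Duhamel term. -/
lemma mixedNorm_toL10_duhamelVersion_le [IsProbabilityMeasure P] (hβ : IsFilteredBrownian P 𝔽 β)
    (hb : IsStronglyPredictable 𝔽 b) (hbβ : ∀ᵐ ω ∂P, ∀ t, b t ω = β t ω)
    (hg : IsStronglyPredictable 𝔽 g) (hfin : mixedNorm P 4 1 s T g < ∞) :
    (∀ᵐ z ∂(timeVolume.restrict (Set.Ioc s (s + T))).prod P,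
      eLpNorm (duhamelVersion b g s z.1 z.2) 10 volume < ∞) ∧
    mixedNorm P 4 5 s T (fun t ω => toL10 (duhamelVersion b g s t ω))
      ≤ (92160 * ENNReal.ofReal T ^ (1 / 2 : ℝ)) ^ (1 / 5 : ℝ) * mixedNorm P 4 1 s T g := by
  set a := amplitude b g with ha_def
  have ha : Measurable a := measurable_amplitude hb hg
  have had : ∀ σ η, Measurable[𝔽 σ] fun ω => a ((σ, ω), η) := measurable_amplitude_apply hb hg
  have hbm := (stronglyMeasurable_uncurry_of_isStronglyPredictable hb).measurable
  have hgm := (stronglyMeasurable_uncurry_of_isStronglyPredictable hg).measurable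
  set F : Ω → ℝ≥0∞ := fun ω => ∫⁻ σ in Set.Ioc s (s + T), ‖g σ ω‖ₑ ∂timeVolume with hF
  have hFm : Measurable F := by
    have h : Measurable fun p : Ω × ℝ≥0 => ‖g p.2 p.1‖ₑ := (hgm.comp measurable_swap :).enorm
    exact h.lintegral_prod_right'
  have hE : ∫⁻ ω, F ω ^ 4 ∂P < ∞ := by
    rw [mixedNorm_four_one_eq] at hfin
    exact (ENNReal.rpow_lt_top_iff_of_pos (by norm_num)).1 hfin
  have hYm := measurable_densityEnergy ha hbm s
  set Y : Ω → ℝ≥0∞ := fun ω => ∫⁻ t in Set.Ioc s (s + T), densityEnergy a b s t ω ∂timeVolume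
    with hY
  have hYm' : Measurable Y := by
    have h : Measurable fun p : Ω × ℝ≥0 => densityEnergy a b s p.2 p.1 :=
      (hYm.comp measurable_swap :)
    exact h.lintegral_prod_right'
  have hYle : ∫⁻ ω, Y ω ∂P ≤ 2 * ENNReal.ofReal T ^ (1 / 2 : ℝ) * ∫⁻ ω, F ω ^ 4 ∂P := by
    have h := lintegral_densityEnergy_le (s := s) (T := T) hβ hbm hbβ ha had
    simp only [ha_def, amplitudeNorm_amplitude] at h
    exact h hE
  have hFfin : ∀ᵐ ω ∂P, F ω < ∞ := ae_lintegral_enorm_lt_top hg hfin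
  have hYfin : ∀ᵐ ω ∂P, Y ω < ∞ :=
    ae_lt_top hYm' (ne_top_of_le_ne_top (by finiteness) hYle)
  have hpt : ∀ ω, F ω < ∞ → ∀ t ∈ Set.Ioc s (s + T),
      eLpNorm (duhamelVersion b g s t ω) 10 volume ^ 5
        ≤ 46080 * F ω * densityEnergy a b s t ω := by
    intro ω hω t ht
    have hle : ∫⁻ σ in Set.Ioc s t, ‖g σ ω‖ₑ ∂timeVolume ≤ F ω :=
      lintegral_mono_set (Set.Ioc_subset_Ioc_right ht.2)
    refine (eLpNorm_duhamelVersion_le hb hg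
      (integrableOn_pullBack hb hg (hle.trans_lt hω))).trans ?_
    rw [densityEnergy]
    gcongr
  refine ⟨?_, ?_⟩
  · have hmeas : MeasurableSet {z : ℝ≥0 × Ω |
        eLpNorm (duhamelVersion b g s z.1 z.2) 10 volume < ∞} :=
      measurableSet_lt (measurable_eLpNorm_ten.comp
        (stronglyMeasurable_uncurry_of_isStronglyPredictable
          (isStronglyPredictable_duhamelVersion hb hg s)).measurable) measurable_const
    rw [Measure.ae_prod_iff_ae_ae hmeas, Measure.ae_ae_comm hmeas]
    filter_upwards [hFfin, hYfin] with ω h1 h2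
    have h3 : Measurable fun t => densityEnergy a b s t ω :=
      (hYm.comp measurable_prodMk_right :)
    filter_upwards [ae_lt_top h3 h2.ne, ae_restrict_mem measurableSet_Ioc] with t h4 h5
    have h6 := (hpt ω h1 t h5).trans_lt (by finiteness : 46080 * F ω * densityEnergy a b s t ω < ∞)
    exact ENNReal.pow_lt_top_iff.1 h6 |>.resolve_right (by norm_num)
  · have hN : ∀ᵐ ω ∂P, eLpNorm (fun t => toL10 (duhamelVersion b g s t ω)) 5
        (timeVolume.restrict (Set.Ioc s (s + T))) ^ 5 ≤ 46080 * F ω * Y ω := by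
      filter_upwards [hFfin] with ω hω
      rw [eLpNorm_five_pow_eq, hY, ← lintegral_const_mul' _ _ (by finiteness)]
      refine setLIntegral_mono' measurableSet_Ioc fun t ht => ?_
      refine le_trans ?_ (hpt ω hω t ht)
      gcongr
      exact enorm_toL10_le _
    have h := lintegral_pow_four_le hFm.aemeasurable hYm'.aemeasurable hN (by norm_num) hYle
    rw [mixedNorm_four_one_eq, mixedNorm, eLpNorm_four_eq]
    simp only [enorm_eq_self]
    refine (ENNReal.rpow_le_rpow h (by norm_num : (0 : ℝ) ≤ 1 / 4)).trans (le_of_eq ?_)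
    rw [ENNReal.mul_rpow_of_nonneg _ _ (by norm_num), ← ENNReal.rpow_mul, ← mul_assoc]
    norm_num [hF]

end SpaceTimeEstimate

theorem proposition3p6 :
    ∃ κ : ℝ, 0 < κ ∧
      ∀ (Ω : Type*) (mΩ : MeasurableSpace Ω) (P : Measure Ω) (_ : IsProbabilityMeasure P)
        (𝔽 : Filtration ℝ≥0 mΩ) (β : ℝ≥0 → Ω → ℝ) (_ : IsFilteredBrownian P 𝔽 β)
        (s T : ℝ≥0) (f : ℝ≥0 → Ω → L2R) (_ : MemMixedPredictable P 𝔽 4 1 s T f),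
        -- almost surely, the Bochner integral defining the Duhamel term exists for all times
        (∀ᵐ ω ∂P, ∀ t ∈ Set.Icc s (s + T),
          IntegrableOn (fun σ => noisePropagator β t σ ω (f σ ω)) (Set.Ioc s t) timeVolume) ∧
        -- the Duhamel term is, as a function of `x`, an element `v` of the claimed space
        ∃ v : ℝ≥0 → Ω → L10R,
          (∀ᵐ z ∂((timeVolume.restrict (Set.Ioc s (s + T))).prod P),
            v z.1 z.2 =ᵐ[volume] duhamel β f s z.1 z.2) ∧
          MemMixedPredictable P 𝔽 4 5 s T v ∧
          mixedNorm P 4 5 s T v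
            ≤ ENNReal.ofReal (κ * (T : ℝ) ^ (1 / 10 : ℝ)) * mixedNorm P 4 1 s T f := by
  -- `92160 = 2 * 46080`, from the local smoothing and the Gagliardo–Nirenberg inequalities
  refine ⟨92160 ^ (1 / 5 : ℝ), by positivity, ?_⟩
  intro Ω mΩ P _ 𝔽 β hβ s T f hf
  obtain ⟨g, hg, hfg⟩ := hf.exists_predictable
  set b := leftLimitProcess β
  have hb : IsStronglyPredictable 𝔽 b := isStronglyPredictable_leftLimitProcess hβ.adapted
  have hbβ : ∀ᵐ ω ∂P, ∀ t, b t ω = β t ω := by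
    filter_upwards [hβ.brownian.cont] with ω hω t
    exact leftLimitProcess_eq_of_continuous hω t
  have hfg' : ∀ᵐ ω ∂P, ∀ᵐ σ ∂timeVolume.restrict (Set.Ioc s (s + T)), f σ ω = g σ ω :=
    Measure.ae_ae_of_ae_prod (Measure.measurePreserving_swap.quasiMeasurePreserving.ae hfg)
  have hnorm : mixedNorm P 4 1 s T f = mixedNorm P 4 1 s T g := by
    refine eLpNorm_congr_ae ?_
    filter_upwards [hfg'] with ω hω
    exact eLpNorm_congr_ae hω
  have hgfin : mixedNorm P 4 1 s T g < ∞ := hnorm ▸ hf.norm_lt_top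
  have hi : ∀ᵐ ω ∂P, ∀ t ∈ Set.Icc s (s + T),
      IntegrableOn (fun σ => pullBack b g σ ω) (Set.Ioc s t) timeVolume := by
    filter_upwards [ae_lintegral_enorm_lt_top hg hgfin] with ω hω t ht
    exact (integrableOn_pullBack hb hg hω).mono_set (Set.Ioc_subset_Ioc_right ht.2)
  have hfgt : ∀ᵐ ω ∂P, ∀ t ∈ Set.Icc s (s + T),
      ∀ᵐ σ ∂timeVolume.restrict (Set.Ioc s t), f σ ω = g σ ω := by
    filter_upwards [hfg'] with ω hω t ht
    exact ae_restrict_of_ae_restrict_of_subset (Set.Ioc_subset_Ioc_right ht.2) hω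
  obtain ⟨hten, hle⟩ := mixedNorm_toL10_duhamelVersion_le hβ hb hbβ hg hgfin
  have hconst : (92160 * ENNReal.ofReal T ^ (1 / 2 : ℝ)) ^ (1 / 5 : ℝ)
      = ENNReal.ofReal (92160 ^ (1 / 5 : ℝ) * (T : ℝ) ^ (1 / 10 : ℝ)) := by
    rw [ENNReal.mul_rpow_of_nonneg _ _ (by norm_num), ← ENNReal.rpow_mul,
      ENNReal.ofReal_mul (by positivity), ← ENNReal.ofReal_rpow_of_nonneg (by norm_num)
      (by norm_num), ← ENNReal.ofReal_rpow_of_nonneg T.coe_nonneg (by norm_num)]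
    norm_num
  rw [hconst, ← hnorm] at hle
  refine ⟨?_, fun t ω => toL10 (duhamelVersion b g s t ω), ?_,
    ⟨⟨fun t ω => toL10 (duhamelVersion b g s t ω), ?_, ae_of_all _ fun _ => rfl⟩,
    hle.trans_lt (ENNReal.mul_lt_top ENNReal.ofReal_lt_top hf.norm_lt_top)⟩, hle⟩
  · filter_upwards [hbβ, hi, hfgt] with ω h1 h2 h3 t ht
    exact ((h2 t ht).schrodingerGroup (b t ω)).congr (noisePropagator_ae_eq h1 (h3 t ht)).symm
  · filter_upwards [hten, Measure.quasiMeasurePreserving_fst.ae (ae_restrict_mem measurableSet_Ioc),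
      Measure.quasiMeasurePreserving_snd.ae (hbβ.and (hi.and hfgt))] with z h1 h2 ⟨h3, h4, h5⟩
    have hz : z.1 ∈ Set.Icc s (s + T) := Set.Ioc_subset_Icc_self h2
    rw [duhamel_eq_duhamelVersion h3 (h5 _ hz) (h4 _ hz)]
    exact toL10_ae_eq h1
  · have h : Measurable[𝔽.predictable] fun z : ℝ≥0 × Ω => toL10 (duhamelVersion b g s z.1 z.2) :=
      measurable_toL10.comp (isStronglyPredictable_duhamelVersion hb hg s).measurable
    exact h.stronglyMeasurable
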